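/- **Setting.** Let $k\ge 1$, let $M_k=\{e_1,\dots,e_k,f_1,\dots,f_k\}$ be a set of markers, and let $\mathcal M$ be a finite-state Markov chain with initial state $s_{in}$, transition probabilities $\mathbf P(s,s')$ and an observation $\mathrm{Obs}(s)\subseteq M_k$ for every state $s$. A run $s_0s_1s_2\cdots$ is *good* if for some $i$ it has $e_i\in \mathrm{Obs}(s_n)$ for infinitely many $n$ and $f_i\in\mathrm{Obs}(s_n)$ for only finitely many $n$. Let $P_{good}$ be the probability that the run of $\mathcal M$ from $s_{in}$ is good, and assume $P_{good}>0$. **Strategy.** The length of a finite path $s_0\cdots s_m$ is $m$, and its second half is $s_{\lceil m/2\rceil}\cdots s_m$. A finite path is good if it has length $0$ or if, for some $i$, one of its states is marked $e_i$ and none is marked $f_i$. The strategy $\mathfrak S[f]$ works in phases $n=1,2,3,\dots$; phase $n$ begins after the $(n-1)$-th restart (phase $1$ at the beginning), in state $s_{in}$. In phase $n$ the chain is sampled in blocks of $2f(n)$ steps; at the end of each block, the chain is restarted (it moves to $s_{in}$, and phase $n$ ends) if the second half of the path executed in this phase is not good, and otherwise sampling continues. Let $S$ be the number of steps executed up to and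 including the last restart: $S=0$ if there is no restart, and $S=\infty$ if there are infinitely many. **Progress radius and progress probability.** A bottom strongly connected component (BSCC) $B$ of the graph with edges $\{(s,s'):\mathbf P(s,s')>0\}$ is $i$-good if it has a state marked $e_i$ and no state marked $f_i$; it is good if it is $i$-good for some $i$, and bad otherwise. Let $B_\gamma$ (resp. $B_\beta$) be the set of states in good (resp. bad) BSCCs and $S_\gamma$ (resp. $S_\beta$) the set of states from which $B_\gamma$ (resp. $B_\beta$) can be reached. A path $\pi$ of positive length starting at $s$ is a *good progress path* if either $s\in S_\gamma\setminus B_\gamma$ and $\pi$ ends in $B_\gamma$, or $s$ lies in an $i$-good BSCC for some $i$ such that $\pi$ ends at a state marked $e_i$. It is a *bad progress path* if either $s\in S_\beta\setminus B_\beta$ and $\pi$ ends in $B_\beta$, or $s$ lies in a bad BSCC $B$ and, for every $i$ such that some state of $B$ is marked $e_i$, $\pi$ visits a state marked $f_i$. (Two conventions are possible for the last condition: the starting state of $\pi$ counts as visited, or it does not. The theorem holds for either.) Let $r_\gamma$ be the maximum over $s\in S_\gamma\setminus B_\gamma$ of the length of a shortest good progress path from $s$, and $p_\gamma$ the minimum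 over the same $s$ of the probability that the random path of length $r_\gamma$ starting at $s$ contains a good progress path. Let $R_\gamma$ and $P_\gamma$ be defined in the same way with $s$ ranging over $B_\gamma$, and $r_\beta,p_\beta$ and $R_\beta,P_\beta$ in the same way with bad progress paths and $S_\beta\setminus B_\beta$, $B_\beta$. The *progress radius* is $R_m=\max(r_\gamma,R_\gamma,r_\beta,R_\beta)$ and the *progress probability* is $P_m=\min(p_\gamma,P_\gamma,p_\beta,P_\beta)$, where quantities whose range of states is empty are left out. **Theorem.** There is an absolute constant $K$ such that for all integers $c\ge1$ and $k\ge 1$ and all finite-state Markov chains $\mathcal M$ with observations in $2^{M_k}$ and $P_{good}>0$, the strategy $\mathfrak S[n\mapsto n^c]$ satisfies $$\mathbb E[S]\;\le\; K\left((c+1)!\cdot 2^c\left(\frac{R_m}{P_m}\right)^{1+1/c}+\frac{2^c\,(c+1)!}{P_{good}^{\,c+1}}+(c+1)!\,(2c)^{c+1}\right).$$ -/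

import Mathlib

open MeasureTheory ProbabilityTheory
open scoped ENNReal Nat

/-- A partially observable Markov chain with states `S` and observations `O`.  The rows of the
transition matrix are probability mass functions.  Finiteness of `S` is required where chains are
quantified over (the chain induced by a strategy on a decision process has infinitely many states). -/
structure POMC (S O : Type*) where
  init : S
  obs : S → O
  step : S → PMF S

/-- A partially observable Markov decision process with actions `A`. -/
structure POMDP (S O A : Type*) where
  init : S
  obs : S → O
  step : S → A → PMF S

/-- A strategy `(O × A)* O → A`: it sees the past observations and actions, and the current
observation. -/
abbrev Strategy (O A : Type*) := List (O × A) → O → A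

/-- Elements of `(S × A)* × S`, the states of the chain induced by a strategy. -/
@[ext] structure History (S A : Type*) where
  past : List (S × A)
  last : S

instance {S A : Type*} : MeasurableSpace (History S A) := ⊤

instance {S A : Type*} : DiscreteMeasurableSpace (History S A) := ⟨fun _ => trivial⟩

instance {S A : Type*} [Countable S] [Countable A] : Countable (History S A) :=
  Function.Injective.countable (f := fun h : History S A => (h.past, h.last))
    (by
      intro a b hab
      simp only [Prod.mk.injEq] at hab
      exact History.ext hab.1 hab.2)

/-- The two actions of a restart process. -/
inductive RestartAction
  | restart
  | cont
  deriving DecidableEq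

instance : Countable RestartAction :=
  Function.Injective.countable (f := fun a : RestartAction => match a with | .restart => 0 | .cont => 1)
    (by intro a b; cases a <;> cases b <;> simp)

namespace POMDP

/-- The chain induced by a strategy on a decision process. -/
noncomputable def induced {S O A : Type*} (D : POMDP S O A) (σ : Strategy O A) :
    POMC (History S A) O where
  init := ⟨[], D.init⟩
  obs h := D.obs h.last
  step h :=
    let a := σ (h.past.map fun p => (D.obs p.1, p.2)) (D.obs h.last)
    (D.step h.last a).map fun s' => ⟨h.past ++ [(h.last, a)], s'⟩

end POMDP

namespace POMC

section General

variable {S O : Type*} (M : POMC S O)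

/-- The restart process: in every state one may go back to the initial state, or continue. -/
noncomputable def restartMDP : POMDP S O RestartAction where
  init := M.init
  obs := M.obs
  step s a := match a with
    | .restart => PMF.pure M.init
    | .cont => M.step s

/-- The next state, given the states visited at the times `0, …, n`. -/
noncomputable def stepKernel [Countable S] [MeasurableSpace S] [DiscreteMeasurableSpace S]
    (n : ℕ) : Kernel (Π _ : Finset.Iic n, S) S :=
  Kernel.comap ⟨fun s => (M.step s).toMeasure, .of_discrete⟩
    (fun h : (Π _ : Finset.Iic n, S) => h ⟨n, Finset.mem_Iic.2 le_rfl⟩) (measurable_pi_apply _)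

instance [Countable S] [MeasurableSpace S] [DiscreteMeasurableSpace S] (n : ℕ) :
    IsMarkovKernel (M.stepKernel n) :=
  ⟨fun h => by
    rw [stepKernel, Kernel.comap_apply]
    exact PMF.toMeasure.isProbabilityMeasure _⟩

/-- The law of the infinite run that starts in the state `s`. -/
noncomputable def runMeasure [Countable S] [MeasurableSpace S] [DiscreteMeasurableSpace S]
    (s : S) : Measure (ℕ → S) :=
  Kernel.traj (X := fun _ => S) M.stepKernel 0 (fun _ => s)

/-- The edges of the graph of the chain. -/
def Edge (s t : S) : Prop := 0 < M.step s t

def Reach : S → S → Prop := Relation.ReflTransGen M.Edge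

def StronglyConnected (B : Set S) : Prop := B.Nonempty ∧ ∀ s ∈ B, ∀ t ∈ B, M.Reach s t

/-- (The vertex sets of) bottom strongly connected components. -/
def IsBSCC (B : Set S) : Prop :=
  Maximal M.StronglyConnected B ∧ ∀ s ∈ B, ∀ t, M.Edge s t → t ∈ B

/-- The states from which the set `B` can be reached. -/
def canReach (B : Set S) : Set S := {s | ∃ t ∈ B, M.Reach s t}

/-- `π 0, …, π m` is a path of length `m` of the graph of the chain.  (Finite paths are represented
by functions on `ℕ`, whose values after `m` are irrelevant.) -/
def IsPath (π : ℕ → S) (m : ℕ) : Prop := ∀ n < m, M.Edge (π n) (π (n + 1))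

/-- For a family `prog` of finite paths (`prog π m` is about the path `π 0, …, π m`): the maximum
over `s ∈ X` of the length of a shortest path in the family that starts at `s`. -/
noncomputable def radius (prog : (ℕ → S) → ℕ → Prop) (X : Set S) : ℕ :=
  sSup ((fun s => sInf {m | ∃ π : ℕ → S, π 0 = s ∧ prog π m}) '' X)

/-- The minimum over `s ∈ X` of the probability that a path of length `r` starting at `s` contains
a path of the family `prog`.  It is `⊤`, hence irrelevant in minima, if `X` is empty. -/
noncomputable def prob [Countable S] [MeasurableSpace S] [DiscreteMeasurableSpace S]
    (prog : (ℕ → S) → ℕ → Prop) (X : Set S) (r : ℕ) : ℝ≥0∞ :=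
  ⨅ s ∈ X, M.runMeasure s {ρ | ∃ a m, a + m ≤ r ∧ prog (fun n => ρ (a + n)) m}

end General

end POMC

/-- The markers `e_1, …, e_k, f_1, …, f_k`. -/
inductive Marker (k : ℕ)
  | e (i : Fin k)
  | f (i : Fin k)

/-- The Rabin language: for some `j`, the marker `e_j` occurs infinitely often and `f_j` finitely
often. -/
def rabinLanguage (k : ℕ) : Set (ℕ → Set (Marker k)) :=
  {w | ∃ j, {n | Marker.e j ∈ w n}.Infinite ∧ {n | Marker.f j ∈ w n}.Finite}

section RestartStrategy

variable {k : ℕ}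

/-- Goodness of a finite path, in terms of its list of observations (a path of length `m` has
`m + 1` observations). -/
def GoodPath (w : List (Set (Marker k))) : Prop :=
  ∃ i, w.length ≤ 1 ∨ ((∃ α ∈ w, Marker.e i ∈ α) ∧ ∀ α ∈ w, Marker.f i ∉ α)

/-- The second half of a path `s_0 … s_m` (given by its `m + 1` observations) is
`s_⌈m/2⌉ … s_m`. -/
def secondHalf (w : List (Set (Marker k))) : List (Set (Marker k)) :=
  w.drop (w.length / 2)

open Classical in
/-- The restart strategy for `f`.  Let `π` be the path, of length `m`, executed since the last
restart (or since the beginning), and let `n - 1` be the number of restarts so far.  The chain is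
sampled in blocks of `2 f(n)` steps, and it is restarted if at the end of a block the second half of
`π` is not good. -/
noncomputable def restartStrategy (f : ℕ → ℕ) : Strategy (Set (Marker k)) RestartAction :=
  fun l o =>
    let π := (l.rtakeWhile fun p => p.2 = RestartAction.cont).map Prod.fst ++ [o]
    let m := π.length - 1
    let n := (l.map Prod.snd).count RestartAction.restart + 1
    if 2 * f n ∣ m ∧ ¬ GoodPath (secondHalf π) then RestartAction.restart else RestartAction.cont

end RestartStrategy

/-- The number `S(ρ)` of steps up to the last restart (included) in a run of the chain induced on a
restart process; it is `0` if there is no restart, and `∞` if there are infinitely many.  The step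
from time `n` to time `n + 1` appends the action taken to the past. -/
noncomputable def stepsToLastRestart {S : Type*} (ρ : ℕ → History S RestartAction) : ℝ≥0∞ :=
  ⨆ (n : ℕ) (_ : ∃ l s, (ρ (n + 1)).past = l ++ [(s, RestartAction.restart)]), ((n + 1 : ℕ) : ℝ≥0∞)

namespace POMC

variable {k : ℕ} {S : Type*} (M : POMC S (Set (Marker k)))

/-- The probability of the good runs. -/
noncomputable def Pgood [Countable S] [MeasurableSpace S] [DiscreteMeasurableSpace S] : ℝ≥0∞ :=
  M.runMeasure M.init {ρ | (fun n => M.obs (ρ n)) ∈ rabinLanguage k}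

/-- A set of states is `i`-good if it has a state marked `e_i` and none marked `f_i`. -/
def IsGoodFor (i : Fin k) (B : Set S) : Prop :=
  (∃ s ∈ B, Marker.e i ∈ M.obs s) ∧ ∀ s ∈ B, Marker.f i ∉ M.obs s

/-- The states in good bottom components. -/
def goodBottom : Set S := {s | ∃ B, M.IsBSCC B ∧ s ∈ B ∧ ∃ i, M.IsGoodFor i B}

/-- The states in bad bottom components. -/
def badBottom : Set S := {s | ∃ B, M.IsBSCC B ∧ s ∈ B ∧ ¬ ∃ i, M.IsGoodFor i B}

/-- `π 0, …, π m` is a good progress path. -/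
def GoodProgress (π : ℕ → S) (m : ℕ) : Prop :=
  0 < m ∧ M.IsPath π m ∧
    ((π 0 ∈ M.canReach M.goodBottom \ M.goodBottom ∧ π m ∈ M.goodBottom) ∨
      ∃ B i, M.IsBSCC B ∧ π 0 ∈ B ∧ M.IsGoodFor i B ∧ Marker.e i ∈ M.obs (π m))

/-- `π 0, …, π m` is a bad progress path.  From a bad bottom component `B`, the path has to visit
the marker `f_i` for every `i` such that `e_i` occurs in `B`.  With `v = 0` the visit may be at any
state of the path; with `v = 1` the starting state does not count. -/
def BadProgress (v : ℕ) (π : ℕ → S) (m : ℕ) : Prop :=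
  0 < m ∧ M.IsPath π m ∧
    ((π 0 ∈ M.canReach M.badBottom \ M.badBottom ∧ π m ∈ M.badBottom) ∨
      ∃ B, M.IsBSCC B ∧ π 0 ∈ B ∧ (¬ ∃ i, M.IsGoodFor i B) ∧
        ∀ i, (∃ t ∈ B, Marker.e i ∈ M.obs t) →
          ∃ n, v ≤ n ∧ n ≤ m ∧ Marker.f i ∈ M.obs (π n))

/-- The good-reachability radius. -/
noncomputable def rGood : ℕ := radius M.GoodProgress (M.canReach M.goodBottom \ M.goodBottom)

/-- The good-witness radius. -/
noncomputable def RGood : ℕ := radius M.GoodProgress M.goodBottom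

/-- The bad-reachability radius. -/
noncomputable def rBad (v : ℕ) : ℕ :=
  radius (M.BadProgress v) (M.canReach M.badBottom \ M.badBottom)

/-- The bad-witness radius. -/
noncomputable def RBad (v : ℕ) : ℕ := radius (M.BadProgress v) M.badBottom

/-- The progress radius.  (A radius whose range of states is empty is `0`, and does not count.) -/
noncomputable def Rm (v : ℕ) : ℕ := max (max M.rGood M.RGood) (max (M.rBad v) (M.RBad v))

/-- The progress probability, the minimum of the good-reachability, good-witness, bad-reachability
and bad-witness probabilities. -/
noncomputable def Pm [Countable S] [MeasurableSpace S] [DiscreteMeasurableSpace S] (v : ℕ) :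
    ℝ≥0∞ :=
  min
    (min (M.prob M.GoodProgress (M.canReach M.goodBottom \ M.goodBottom) M.rGood)
      (M.prob M.GoodProgress M.goodBottom M.RGood))
    (min (M.prob (M.BadProgress v) (M.canReach M.badBottom \ M.badBottom) (M.rBad v))
      (M.prob (M.BadProgress v) M.badBottom (M.RBad v)))

/-- The expected number `E[S]` of steps to the last restart under the restart strategy for `f`. -/
noncomputable def expectedSteps [Countable S] (f : ℕ → ℕ) : ℝ≥0∞ :=
  let N := M.restartMDP.induced (restartStrategy f)
  ∫⁻ ρ, stepsToLastRestart ρ ∂(N.runMeasure N.init)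

end POMC

/-! Let W be `window`: the progress radius times ⌈1/P_m⌉. In a run of length W, possible progress
fails to occur with probability at most 1/2, because (1-P)^⌈1/P⌉ ≤ 1/e; over j such windows the
failure probability is at most 2^(-j). Everything is reduced to the cost of one phase and the
probability that the phase ends in a restart, both computed in the original chain.

Reduction to phases. On the induced chain of histories, bounds for the expected time of the last
restart come from a verification principle (`lintegral_lastVisit_le`): it suffices to exhibit
functions that satisfy the one-step inequalities. The candidate is the remaining cost of the current
phase plus the restart probability times a value for the next phase, which gives `expectedSteps_le`.
Solving the recursion yields a series, the sum over phases of the cost of a phase times the product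
of the earlier restart probabilities.

One phase, with block length 2F. At the end of a block, at time 2n, the check concerns the window
from n to 2n. Inside a good component a failing check means that the window has no good progress;
inside a bad component a passing check means that it has no bad progress. So a phase that ends late
forces one of three rare events: still transient, a bad component that went unnoticed, or a good
component that is rejected. This gives `phaseCost_le`, an expected cost of at most 4F + 21W. If F ≥
jW, then with probability at least P_good(1 - 2^(-j)) a good component is reached by time F, and
after that all checks pass with conditional probability at least 1 - 2·2^(-j); hence
`restartProb_toReal_le`. The lateness of the good component has to be estimated relative to the
probability of reaching it (`runMeasure_late_le`), so that the loss is proportional to P_good.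

Summation. With j = c + 3 the second bound applies to all phases n > N, where N^c is at most (c+3)W.
The first N phases cost O(N·(c+3)W), which produces the exponent 1 + 1/c. The later ones form a
series of n^c against a geometric sequence with ratio 1 - P_good(1-δ), where δ = 1/(2(c+1)) is small
enough that (1-δ)^(c+1) ≥ 1/2; this produces P_good^(-(c+1)). -/

namespace POMC

/-! ### Runs, shifts and events decided in finite time -/

section Paths

variable {S : Type*}

/-- The run obtained by putting the state `s` in front of `ρ`. -/
def cons (s : S) (ρ : ℕ → S) : ℕ → S
  | 0 => s
  | n + 1 => ρ n

@[simp] lemma cons_zero (s : S) (ρ : ℕ → S) : cons s ρ 0 = s := rfl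

@[simp] lemma cons_succ (s : S) (ρ : ℕ → S) (n : ℕ) : cons s ρ (n + 1) = ρ n := rfl

/-- The run from time `n` on. -/
def shift (n : ℕ) (ρ : ℕ → S) : ℕ → S := fun m => ρ (n + m)

@[simp] lemma shift_apply (n : ℕ) (ρ : ℕ → S) (m : ℕ) : shift n ρ m = ρ (n + m) := rfl

@[simp] lemma shift_zero (ρ : ℕ → S) : shift 0 ρ = ρ := by
  ext m; simp

@[simp] lemma shift_shift (m n : ℕ) (ρ : ℕ → S) :
    shift m (shift n ρ) = shift (n + m) ρ := by
  ext i; simp [add_assoc]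

lemma shift_succ_cons (s : S) (n : ℕ) (ρ : ℕ → S) :
    shift (n + 1) (cons s ρ) = shift n ρ := by
  ext m; simp [shift, add_right_comm _ 1 m]

/-- Membership in `A` is decided by the states at the times `0, …, n`. -/
def DecidedBy (n : ℕ) (A : Set (ℕ → S)) : Prop :=
  ∀ ρ ρ' : ℕ → S, (∀ i ≤ n, ρ i = ρ' i) → ρ ∈ A → ρ' ∈ A

lemma DecidedBy.cons {n : ℕ} {A : Set (ℕ → S)} (h : DecidedBy (n + 1) A) (s : S) :
    DecidedBy n (cons s ⁻¹' A) := by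
  intro ρ ρ' hρ
  refine h _ _ fun i hi => ?_
  cases i with
  | zero => rfl
  | succ i => exact hρ i (by omega)

lemma measurable_cons [MeasurableSpace S] (s : S) : Measurable (cons s) := by
  refine measurable_pi_iff.2 fun n => ?_
  cases n with
  | zero => exact measurable_const
  | succ n => exact measurable_pi_apply n

lemma measurable_shift [MeasurableSpace S] (n : ℕ) : Measurable (shift n : (ℕ → S) → ℕ → S) :=
  measurable_pi_iff.2 fun m => measurable_pi_apply (n + m)

end Paths

/-! ### The law of the run: cylinders and the Markov property -/

section Run

variable {S O : Type*} [Countable S] [MeasurableSpace S] [DiscreteMeasurableSpace S]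

instance (M : POMC S O) (s : S) : IsProbabilityMeasure (M.runMeasure s) := by
  unfold runMeasure; infer_instance

/-- Such an event is the preimage of its own image under restriction to finitely many coordinates,
and every subset of that countable product is measurable. -/
lemma DecidedBy.measurableSet {n : ℕ} {A : Set (ℕ → S)} (h : DecidedBy n A) :
    MeasurableSet A := by
  have hA : A = (Preorder.frestrictLe (π := fun _ => S) n) ⁻¹'
      ((Preorder.frestrictLe (π := fun _ => S) n) '' A) := by
    refine Set.Subset.antisymm (Set.subset_preimage_image _ _) ?_
    rintro ρ ⟨ρ', hρ', he⟩
    refine h ρ' ρ (fun i hi => ?_) hρ'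
    exact congrFun he ⟨i, Finset.mem_Iic.2 hi⟩
  rw [hA]
  exact (Preorder.measurable_frestrictLe n) (MeasurableSet.of_discrete)

/-- The runs that agree with `x` up to time `n`. -/
def cylinder {S : Type*} (n : ℕ) (x : ℕ → S) : Set (ℕ → S) := {ρ | ∀ i ≤ n, ρ i = x i}

lemma decidedBy_cylinder {S : Type*} (n : ℕ) (x : ℕ → S) : DecidedBy n (cylinder n x) :=
  fun _ _ h hρ i hi => (h i hi).symm.trans (hρ i hi)

/-- Probability measures on runs are determined by the probabilities of cylinders. -/
lemma measure_eq_of_cylinder {μ ν : Measure (ℕ → S)} [IsProbabilityMeasure μ]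
    [IsProbabilityMeasure ν] (h : ∀ n x, μ (cylinder n x) = ν (cylinder n x)) : μ = ν := by
  have hm : ∀ n, μ.map (Preorder.frestrictLe (π := fun _ => S) n) =
      ν.map (Preorder.frestrictLe (π := fun _ => S) n) := by
    intro n
    refine Measure.ext_of_singleton fun y => ?_
    rw [Measure.map_apply (Preorder.measurable_frestrictLe n) (.of_discrete),
      Measure.map_apply (Preorder.measurable_frestrictLe n) (.of_discrete)]
    have : (Preorder.frestrictLe (π := fun _ => S) n) ⁻¹' {y} =
        cylinder n fun i => y ⟨min i n, Finset.mem_Iic.2 (min_le_right _ _)⟩ := by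
      ext ρ
      simp only [Set.mem_preimage, Set.mem_singleton_iff, cylinder, Set.mem_ofPred_eq]
      constructor
      · rintro rfl i hi
        simp [hi]
      · intro hρ
        ext ⟨i, hi⟩
        have hi' : i ≤ n := Finset.mem_Iic.1 hi
        have := hρ i hi'
        simp only [hi', min_eq_left] at this
        exact this
    rw [this, h]
  have hP : IsProjectiveMeasureFamily (α := fun _ : ℕ => S) fun I : Finset ℕ => ν.map I.restrict := by
    intro I J hJ
    rw [Measure.map_map (Finset.measurable_restrict₂ hJ) (Finset.measurable_restrict I)]
    rfl
  have h1 : IsProjectiveLimit (α := fun _ : ℕ => S) ν fun I : Finset ℕ => ν.map I.restrict :=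
    fun I => rfl
  have h2 : IsProjectiveLimit (α := fun _ : ℕ => S) μ fun I : Finset ℕ => ν.map I.restrict :=
    (isProjectiveLimit_nat_iff hP μ).2 hm
  exact h2.unique h1

variable (M : POMC S O)

open Classical in
lemma runMeasure_cylinder_zero (s : S) (x : ℕ → S) :
    M.runMeasure s (cylinder 0 x) = if x 0 = s then 1 else 0 := by
  have h := Kernel.traj_map_frestrictLe_apply (X := fun _ => S) (κ := M.stepKernel) 0 0 (fun _ => s)
  rw [Kernel.partialTraj_self, Kernel.id_apply] at h
  have hc : cylinder 0 x = (Preorder.frestrictLe (π := fun _ => S) 0) ⁻¹'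
      {y | y ⟨0, by simp⟩ = x 0} := by
    ext ρ; simp [cylinder]
  rw [hc, ← Measure.map_apply (Preorder.measurable_frestrictLe 0) (.of_discrete), runMeasure, h,
    Measure.dirac_apply' _ (.of_discrete)]
  simp [Set.indicator_apply, eq_comm]

lemma runMeasure_cylinder_succ (s : S) (n : ℕ) (x : ℕ → S) :
    M.runMeasure s (cylinder (n + 1) x) =
      M.runMeasure s (cylinder n x) * M.step (x n) (x (n + 1)) := by
  have h := Kernel.partialTraj_compProd_eq_map_traj (X := fun _ => S) (κ := M.stepKernel)
    (Nat.zero_le n) (x₀ := fun _ => s)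
  rw [← Kernel.traj_map_frestrictLe_apply] at h
  set A : Set (Π _ : Finset.Iic n, S) := {y | ∀ i, y i = x i} with hA
  have h1 : cylinder (n + 1) x = (fun ρ : ℕ → S =>
      (Preorder.frestrictLe (π := fun _ => S) n ρ, ρ (n + 1))) ⁻¹' (A ×ˢ {x (n + 1)}) := by
    ext ρ
    simp only [cylinder, Set.mem_ofPred_eq, hA, Set.mem_preimage, Set.mem_prod,
      Set.mem_singleton_iff, Preorder.frestrictLe_apply, Subtype.forall, Finset.mem_Iic]
    constructor
    · exact fun h => ⟨fun i hi => h i (by omega), h _ le_rfl⟩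
    · rintro ⟨h1, h2⟩ i hi
      rcases Nat.lt_or_ge i (n + 1) with h | h
      · exact h1 i (by omega)
      · obtain rfl : i = n + 1 := by omega
        exact h2
  have h0 : cylinder n x = (Preorder.frestrictLe (π := fun _ => S) n) ⁻¹' A := by
    ext ρ
    simp [cylinder, hA]
  have hm : Measurable (fun ρ : ℕ → S =>
      (Preorder.frestrictLe (π := fun _ => S) n ρ, ρ (n + 1))) :=
    (Preorder.measurable_frestrictLe n).prodMk (measurable_pi_apply _)
  rw [h1, h0, ← Measure.map_apply hm (MeasurableSet.of_discrete.prod MeasurableSet.of_discrete),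
    ← Measure.map_apply (Preorder.measurable_frestrictLe n) (.of_discrete), runMeasure, ← h,
    Measure.compProd_apply_prod .of_discrete .of_discrete]
  have : ∀ y ∈ A, M.stepKernel n y {x (n + 1)} = M.step (x n) (x (n + 1)) := by
    intro y hy
    rw [stepKernel, Kernel.comap_apply]
    change (M.step _).toMeasure _ = _
    rw [PMF.toMeasure_apply_singleton _ _ (.of_discrete), hy]
  rw [setLIntegral_congr_fun (.of_discrete) this, setLIntegral_const, mul_comm]

open Classical in
lemma runMeasure_cylinder (s : S) (n : ℕ) (x : ℕ → S) :
    M.runMeasure s (cylinder n x) =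
      if x 0 = s then ∏ i ∈ Finset.range n, M.step (x i) (x (i + 1)) else 0 := by
  induction n with
  | zero => simp [runMeasure_cylinder_zero]
  | succ n ih =>
    rw [runMeasure_cylinder_succ, ih, Finset.prod_range_succ]
    split_ifs <;> simp

/-- First-step decomposition: both sides are probability measures that give the same product of
transition probabilities to every cylinder. The Markov property and all one-step equations below
rest on it. -/
lemma runMeasure_eq_sum (s : S) :
    M.runMeasure s = Measure.sum fun t => M.step s t • (M.runMeasure t).map (cons s) := by
  classical
  have hp : IsProbabilityMeasure
      (Measure.sum fun t => M.step s t • (M.runMeasure t).map (cons s)) := by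
    refine ⟨?_⟩
    rw [Measure.sum_apply _ .univ]
    simp only [Measure.smul_apply, smul_eq_mul]
    rw [← (M.step s).tsum_coe]
    refine tsum_congr fun t => ?_
    have := Measure.isProbabilityMeasure_map (μ := M.runMeasure t) (measurable_cons s).aemeasurable
    rw [measure_univ, mul_one]
  refine measure_eq_of_cylinder fun n x => ?_
  have hmeas := (decidedBy_cylinder n x).measurableSet
  rw [Measure.sum_apply _ hmeas]
  simp only [Measure.smul_apply, smul_eq_mul, Measure.map_apply (measurable_cons s) hmeas]
  rw [runMeasure_cylinder]
  cases n with
  | zero =>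
    have : ∀ t, M.runMeasure t (cons s ⁻¹' cylinder 0 x) = if x 0 = s then 1 else 0 := by
      intro t
      split_ifs with h
      · convert measure_univ (μ := M.runMeasure t)
        ext ρ; simp [cylinder, h]
      · convert measure_empty (μ := M.runMeasure t)
        ext ρ; simpa [cylinder, eq_comm] using Ne.symm h
    simp only [this, ENNReal.tsum_mul_right, PMF.tsum_coe, one_mul, Finset.range_zero,
      Finset.prod_empty]
  | succ n =>
    have hx : ∀ t, M.runMeasure t (cons s ⁻¹' cylinder (n + 1) x) =
        if x 0 = s then M.runMeasure t (cylinder n fun i => x (i + 1)) else 0 := by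
      intro t
      split_ifs with h
      · congr 1
        ext ρ
        simp only [cylinder, Set.mem_preimage, Set.mem_ofPred_eq]
        constructor
        · exact fun hρ i hi => hρ (i + 1) (by omega)
        · intro hρ i hi
          cases i with
          | zero => simp [h]
          | succ i => exact hρ i (by omega)
      · convert measure_empty (μ := M.runMeasure t)
        ext ρ
        simp only [cylinder, Set.mem_preimage, Set.mem_ofPred_eq, Set.mem_empty_iff_false, iff_false]
        intro hρ
        exact h (hρ 0 (by omega)).symm
    simp only [hx]
    split_ifs with h
    · simp only [runMeasure_cylinder]
      rw [tsum_eq_single (x 1)]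
      · simp [Finset.prod_range_succ', h, mul_comm]
      · intro t ht
        simp [Ne.symm ht]
    · simp

lemma lintegral_runMeasure (s : S) {f : (ℕ → S) → ℝ≥0∞} (hf : Measurable f) :
    ∫⁻ ρ, f ρ ∂M.runMeasure s = ∑' t, M.step s t * ∫⁻ ρ, f (cons s ρ) ∂M.runMeasure t := by
  conv_lhs => rw [runMeasure_eq_sum]
  rw [lintegral_sum_measure]
  refine tsum_congr fun t => ?_
  rw [lintegral_smul_measure, lintegral_map hf (measurable_cons s), smul_eq_mul]

lemma runMeasure_apply (s : S) {E : Set (ℕ → S)} (hE : MeasurableSet E) :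
    M.runMeasure s E = ∑' t, M.step s t * M.runMeasure t (cons s ⁻¹' E) := by
  conv_lhs => rw [runMeasure_eq_sum]
  rw [Measure.sum_apply _ hE]
  refine tsum_congr fun t => ?_
  rw [Measure.smul_apply, Measure.map_apply (measurable_cons s) hE, smul_eq_mul]

lemma ae_zero_eq (s : S) : ∀ᵐ ρ ∂M.runMeasure s, ρ 0 = s := by
  classical
  have h := M.runMeasure_cylinder_zero s fun _ => s
  simp only [if_true] at h
  have h2 := (prob_compl_eq_zero_iff (decidedBy_cylinder 0 fun _ => s).measurableSet).2 h
  rw [ae_iff]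
  convert h2 using 2
  ext ρ
  simp [cylinder]

/-- The Markov property at a fixed time. -/
lemma runMeasure_inter_shift (s : S) (n : ℕ) {A E : Set (ℕ → S)} (hA : DecidedBy n A)
    (hE : MeasurableSet E) :
    M.runMeasure s (A ∩ shift n ⁻¹' E) = ∫⁻ ρ in A, M.runMeasure (ρ n) E ∂M.runMeasure s := by
  have hΦ : ∀ n, Measurable fun ρ : ℕ → S => M.runMeasure (ρ n) E := fun n =>
    (Measurable.of_discrete (f := fun t => M.runMeasure t E)).comp (measurable_pi_apply n)
  induction n generalizing s A with
  | zero =>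
    have h0 := M.ae_zero_eq s
    rw [setLIntegral_congr_fun_ae hA.measurableSet (g := fun _ => M.runMeasure s E)
      (by filter_upwards [h0] with ρ h _; rw [h]), setLIntegral_const]
    -- An event decided at time 0 has probability 0 or 1, since the run almost surely starts in `s`;
    -- the constant run tells which.
    by_cases hs : (fun _ => s) ∈ A
    · have : ∀ᵐ ρ ∂M.runMeasure s, ρ ∈ A := by
        filter_upwards [h0] with ρ h
        exact hA _ _ (fun i hi => by obtain rfl : i = 0 := by omega
                                     exact h.symm) hs
      rw [(mem_ae_iff_prob_eq_one hA.measurableSet).1 this, mul_one]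
      refine measure_congr ?_
      filter_upwards [this] with ρ h
      simp only [eq_iff_iff]
      change (ρ ∈ A ∧ shift 0 ρ ∈ E) ↔ ρ ∈ E
      simp [h]
    · have : ∀ᵐ ρ ∂M.runMeasure s, ρ ∉ A := by
        filter_upwards [h0] with ρ h hρ
        exact hs (hA _ _ (fun i hi => by obtain rfl : i = 0 := by omega
                                         exact h) hρ)
      have hz : M.runMeasure s A = 0 := measure_eq_zero_iff_ae_notMem.2 this
      rw [hz, mul_zero]
      exact measure_mono_null Set.inter_subset_left hz
  | succ n ih =>
    rw [M.runMeasure_apply s (hA.measurableSet.inter (measurable_shift _ hE)),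
      ← lintegral_indicator hA.measurableSet,
      M.lintegral_runMeasure s ((hΦ (n + 1)).indicator hA.measurableSet)]
    refine tsum_congr fun t => ?_
    congr 1
    have : cons s ⁻¹' (A ∩ shift (n + 1) ⁻¹' E) = (cons s ⁻¹' A) ∩ shift n ⁻¹' E := by
      ext ρ
      simp [shift_succ_cons]
    rw [this, ih t (hA.cons s), ← lintegral_indicator (hA.cons s).measurableSet]
    rfl

lemma runMeasure_inter_shift_le (s : S) (n : ℕ) {A E : Set (ℕ → S)} (hA : DecidedBy n A)
    (hE : MeasurableSet E) {b : ℝ≥0∞} (hb : ∀ t, M.runMeasure t E ≤ b) :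
    M.runMeasure s (A ∩ shift n ⁻¹' E) ≤ b * M.runMeasure s A := by
  rw [M.runMeasure_inter_shift s n hA hE, ← setLIntegral_const]
  exact lintegral_mono fun ρ => hb _

lemma runMeasure_shift_le (s : S) (n : ℕ) {E : Set (ℕ → S)}
    (hE : MeasurableSet E) {b : ℝ≥0∞} (hb : ∀ t, M.runMeasure t E ≤ b) :
    M.runMeasure s (shift n ⁻¹' E) ≤ b := by
  have := M.runMeasure_inter_shift_le s n (A := Set.univ) (fun _ _ _ _ => trivial) hE hb
  simpa using this

/-- A non-edge is taken in the first step with probability zero from every state, and the Markov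
property moves this to any time. It lets facts about the graph be applied to almost every run. -/
lemma ae_isPath (s : S) : ∀ᵐ ρ ∂M.runMeasure s, ∀ n, M.Edge (ρ n) (ρ (n + 1)) := by
  rw [ae_all_iff]
  intro n
  set E : Set (ℕ → S) := {ρ | ¬ M.Edge (ρ 0) (ρ 1)} with hE
  have hEm : DecidedBy 1 E := by
    intro ρ ρ' h hρ
    simp only [hE, Set.mem_ofPred_eq] at hρ ⊢
    rwa [← h 0 (by omega), ← h 1 (by omega)]
  have h0 : ∀ t, M.runMeasure t E ≤ 0 := by
    intro t
    rw [M.runMeasure_apply t hEm.measurableSet]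
    refine le_of_eq (ENNReal.tsum_eq_zero.2 fun u => ?_)
    by_cases hu : M.Edge t u
    · refine mul_eq_zero_of_right _ (measure_eq_zero_iff_ae_notMem.2 ?_)
      filter_upwards [M.ae_zero_eq u] with ρ h
      simp [hE, h, hu]
    · refine mul_eq_zero_of_left ?_ _
      simpa [Edge] using hu
  exact ae_iff.2 (le_antisymm (M.runMeasure_shift_le s n hEm.measurableSet h0) zero_le)

/-- An event that is unlikely from every state is unlikely to happen in
each of `k` consecutive blocks. -/
lemma runMeasure_iterate_le {r : ℕ} {A : Set (ℕ → S)} (hA : DecidedBy r A) {b : ℝ≥0∞}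
    (hb : ∀ t, M.runMeasure t A ≤ b) (k : ℕ) (s : S) :
    M.runMeasure s {ρ | ∀ j < k, shift (j * r) ρ ∈ A} ≤ b ^ k := by
  have hm : ∀ k, MeasurableSet {ρ : ℕ → S | ∀ j < k, shift (j * r) ρ ∈ A} := by
    intro k
    simp only [Set.ofPred_forall]
    exact .iInter fun j => .iInter fun _ => measurable_shift _ hA.measurableSet
  induction k generalizing s with
  | zero => simp
  | succ k ih =>
    have : {ρ : ℕ → S | ∀ j < k + 1, shift (j * r) ρ ∈ A} =
        A ∩ shift r ⁻¹' {ρ | ∀ j < k, shift (j * r) ρ ∈ A} := by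
      ext ρ
      simp only [Set.mem_ofPred_eq, Set.mem_inter_iff, Set.mem_preimage, shift_shift]
      constructor
      · intro h
        refine ⟨by simpa using h 0 (by omega), fun j hj => ?_⟩
        have := h (j + 1) (by omega)
        rwa [add_mul, one_mul, add_comm] at this
      · rintro ⟨h1, h2⟩ j hj
        cases j with
        | zero => simpa using h1
        | succ j => rw [add_mul, one_mul, add_comm]; exact h2 j (by omega)
    rw [this, pow_succ]
    exact (M.runMeasure_inter_shift_le s r hA (hm k) ih).trans (by gcongr; exact hb s)

end Run

/-! ### Expected time of the last visit to a set -/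

section LastVisit

variable {S O : Type*}

open Classical in
/-- The indicator of a visit to `Q` at one of the times `1, …, H`. -/
noncomputable def visitWithin (Q : Set S) : ℕ → (ℕ → S) → ℝ≥0∞
  | 0, _ => 0
  | H + 1, ρ => if ρ 1 ∈ Q then 1 else visitWithin Q H (shift 1 ρ)

/-- The last of the times `1, …, H` at which `Q` is visited, and `0` if there is none. -/
noncomputable def lastVisitWithin (Q : Set S) : ℕ → (ℕ → S) → ℝ≥0∞
  | 0, _ => 0
  | H + 1, ρ => visitWithin Q (H + 1) ρ + lastVisitWithin Q H (shift 1 ρ)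

lemma visitWithin_eq_one (Q : Set S) {H n : ℕ} (ρ : ℕ → S) (hn : n < H) (hQ : ρ (n + 1) ∈ Q) :
    visitWithin Q H ρ = 1 := by
  induction n generalizing H ρ with
  | zero =>
    obtain ⟨H, rfl⟩ := Nat.exists_eq_add_of_lt hn
    simp [visitWithin, hQ]
  | succ n ih =>
    obtain ⟨H, rfl⟩ : ∃ H', H = H' + 1 := ⟨H - 1, by omega⟩
    rw [visitWithin]
    split_ifs with h
    · rfl
    · exact ih _ (by omega) (by rwa [shift_apply, add_comm])

/-- The recursion adds, over successive shifts, the indicator that a visit is still to come; a visit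
at time `n + 1` makes the first `n + 1` of these indicators equal to 1. -/
lemma le_lastVisitWithin (Q : Set S) {H n : ℕ} (ρ : ℕ → S) (hn : n < H) (hQ : ρ (n + 1) ∈ Q) :
    ((n + 1 : ℕ) : ℝ≥0∞) ≤ lastVisitWithin Q H ρ := by
  induction n generalizing H ρ with
  | zero =>
    obtain ⟨H, rfl⟩ : ∃ H', H = H' + 1 := ⟨H - 1, by omega⟩
    rw [lastVisitWithin, visitWithin_eq_one Q ρ hn hQ]
    simp
  | succ n ih =>
    obtain ⟨H, rfl⟩ : ∃ H', H = H' + 1 := ⟨H - 1, by omega⟩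
    rw [lastVisitWithin, visitWithin_eq_one Q ρ hn hQ, Nat.cast_succ, add_comm]
    gcongr
    exact ih _ (by omega) (by rwa [shift_apply, add_comm])

lemma visitWithin_mono (Q : Set S) (H : ℕ) (ρ : ℕ → S) :
    visitWithin Q H ρ ≤ visitWithin Q (H + 1) ρ := by
  induction H generalizing ρ with
  | zero => simp [visitWithin]
  | succ H ih =>
    rw [visitWithin, visitWithin]
    split_ifs
    · rfl
    · exact ih _

lemma lastVisitWithin_mono (Q : Set S) (H : ℕ) (ρ : ℕ → S) :
    lastVisitWithin Q H ρ ≤ lastVisitWithin Q (H + 1) ρ := by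
  induction H generalizing ρ with
  | zero => simp [lastVisitWithin]
  | succ H ih =>
    rw [lastVisitWithin, lastVisitWithin]
    exact add_le_add (visitWithin_mono Q _ _) (ih _)

variable [MeasurableSpace S] [DiscreteMeasurableSpace S]

lemma measurable_visitWithin (Q : Set S) (H : ℕ) : Measurable (visitWithin Q H) := by
  induction H with
  | zero => exact measurable_const
  | succ H ih =>
    exact Measurable.ite (measurable_pi_apply 1 (MeasurableSet.of_discrete (s := Q)))
      measurable_const (ih.comp (measurable_shift 1))

lemma measurable_lastVisitWithin (Q : Set S) (H : ℕ) : Measurable (lastVisitWithin Q H) := by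
  induction H with
  | zero => exact measurable_const
  | succ H ih =>
    exact (measurable_visitWithin Q (H + 1)).add (ih.comp (measurable_shift 1))

variable [Countable S] (N : POMC S O)

open Classical in
/-- A verification principle: supersolutions `u` and `V` of the one-step equations for the
probability of a visit to `Q` and for the expected time of the last visit to `Q` bound the latter. -/
theorem lintegral_lastVisit_le (Q : Set S) (u V : S → ℝ≥0∞)
    (hu : ∀ s, ∑' t, N.step s t * (if t ∈ Q then 1 else u t) ≤ u s)
    (hV : ∀ s, u s + ∑' t, N.step s t * V t ≤ V s) (s : S) :
    ∫⁻ ρ, (⨆ (n : ℕ) (_ : ρ (n + 1) ∈ Q), ((n + 1 : ℕ) : ℝ≥0∞)) ∂N.runMeasure s ≤ V s := by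
  have h1 : ∀ H s, ∫⁻ ρ, visitWithin Q H ρ ∂N.runMeasure s ≤ u s := by
    intro H
    induction H with
    | zero => simp [visitWithin]
    | succ H ih =>
      intro s
      rw [N.lintegral_runMeasure s (measurable_visitWithin Q _)]
      refine (ENNReal.tsum_le_tsum fun t => ?_).trans (hu s)
      gcongr
      have : ∀ᵐ ρ ∂N.runMeasure t, visitWithin Q (H + 1) (cons s ρ) =
          if t ∈ Q then 1 else visitWithin Q H ρ := by
        filter_upwards [N.ae_zero_eq t] with ρ h
        simp only [visitWithin, cons, h]
        rw [← zero_add 1, shift_succ_cons, shift_zero]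
      rw [lintegral_congr_ae this]
      split_ifs
      · simp
      · exact ih t
  have h2 : ∀ H s, ∫⁻ ρ, lastVisitWithin Q H ρ ∂N.runMeasure s ≤ V s := by
    intro H
    induction H with
    | zero => simp [lastVisitWithin]
    | succ H ih =>
      intro s
      simp only [lastVisitWithin]
      rw [lintegral_add_left (measurable_visitWithin Q _)]
      refine (add_le_add (h1 _ _) ?_).trans (hV s)
      rw [N.lintegral_runMeasure s
        (f := fun ρ => lastVisitWithin Q H (shift 1 ρ))
        ((measurable_lastVisitWithin Q H).comp (measurable_shift 1))]
      refine ENNReal.tsum_le_tsum fun t => ?_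
      gcongr
      refine (lintegral_mono fun ρ => ?_).trans (ih t)
      rw [← zero_add 1, shift_succ_cons, shift_zero]
  -- The two bounds by induction on the horizon are uniform in it, so monotone convergence removes
  -- the horizon.
  calc ∫⁻ ρ, (⨆ (n : ℕ) (_ : ρ (n + 1) ∈ Q), ((n + 1 : ℕ) : ℝ≥0∞)) ∂N.runMeasure s
      ≤ ∫⁻ ρ, ⨆ H, lastVisitWithin Q H ρ ∂N.runMeasure s := by
        refine lintegral_mono fun ρ => iSup₂_le fun n hn => ?_
        exact (le_lastVisitWithin Q ρ (Nat.lt_succ_self n) hn).trans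
          (le_iSup (fun H => lastVisitWithin Q H ρ) (n + 1))
    _ = ⨆ H, ∫⁻ ρ, lastVisitWithin Q H ρ ∂N.runMeasure s :=
        lintegral_iSup (measurable_lastVisitWithin Q)
          (monotone_nat_of_le_succ fun H ρ => lastVisitWithin_mono Q H ρ)
    _ ≤ V s := iSup_le fun H => h2 H s

end LastVisit

end POMC

/-! ### The length of a phase as a function of its bad times -/

section FirstBad

open Classical in
/-- The indicator of `bad t` for some `t`. -/
noncomputable def everBad (bad : ℕ → Prop) : ℝ≥0∞ := if ∃ t, bad t then 1 else 0

/-- There is a time `t` with `bad t`, and none before `j`. -/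
def FirstBadFrom (bad : ℕ → Prop) (j : ℕ) : Prop := (∀ i < j, ¬ bad i) ∧ ∃ t, bad t

open Classical in
/-- The number of steps up to the one that follows the first `t` with `bad t`, and `0` if there is
no such `t`. -/
noncomputable def stepsAfterFirstBad (bad : ℕ → Prop) : ℝ≥0∞ :=
  ∑' j, if FirstBadFrom bad j then 1 else 0

lemma everBad_of_zero {bad : ℕ → Prop} (h : bad 0) : everBad bad = 1 := if_pos ⟨0, h⟩

lemma exists_succ_iff_of_not_zero {bad : ℕ → Prop} (h : ¬ bad 0) :
    (∃ t, bad t) ↔ ∃ t, bad (t + 1) := by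
  constructor
  · rintro ⟨t, ht⟩
    cases t with
    | zero => exact absurd ht h
    | succ t => exact ⟨t, ht⟩
  · rintro ⟨t, ht⟩
    exact ⟨t + 1, ht⟩

lemma everBad_of_not_zero {bad : ℕ → Prop} (h : ¬ bad 0) :
    everBad bad = everBad fun t => bad (t + 1) := by
  classical
  exact if_congr (exists_succ_iff_of_not_zero h) rfl rfl

open Classical in
lemma stepsAfterFirstBad_eq (bad : ℕ → Prop) :
    stepsAfterFirstBad bad =
      everBad bad + ∑' j, if FirstBadFrom bad (j + 1) then 1 else 0 := by
  rw [stepsAfterFirstBad, tsum_eq_zero_add' ENNReal.summable]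
  congr 1
  simp [everBad, FirstBadFrom]

lemma stepsAfterFirstBad_of_zero {bad : ℕ → Prop} (h : bad 0) : stepsAfterFirstBad bad = 1 := by
  classical
  rw [stepsAfterFirstBad_eq, everBad_of_zero h]
  have : ∀ j, ¬ FirstBadFrom bad (j + 1) := fun j hj => hj.1 0 (Nat.succ_pos j) h
  simp [this]

/-- Dropping a first time that is not bad lowers every index by one and removes the term `j = 0`,
which is the indicator that a bad time exists. This is the one-step equation that the verification
principle asks for. -/
lemma stepsAfterFirstBad_of_not_zero {bad : ℕ → Prop} (h : ¬ bad 0) :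
    stepsAfterFirstBad bad = everBad bad + stepsAfterFirstBad fun t => bad (t + 1) := by
  classical
  rw [stepsAfterFirstBad_eq, stepsAfterFirstBad]
  congr 1
  refine tsum_congr fun j => ?_
  have : FirstBadFrom bad (j + 1) ↔ FirstBadFrom (fun t => bad (t + 1)) j := by
    rw [FirstBadFrom, FirstBadFrom, exists_succ_iff_of_not_zero h]
    refine and_congr_left fun _ => ⟨fun h1 i hi => h1 (i + 1) (by omega), fun h1 i hi => ?_⟩
    cases i with
    | zero => exact h
    | succ i => exact h1 i (by omega)
  exact if_congr this rfl rfl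

variable {Ω : Type*} [MeasurableSpace Ω] {bad : Ω → ℕ → Prop}

lemma measurableSet_exists_bad (h : ∀ t, MeasurableSet {ω | bad ω t}) :
    MeasurableSet {ω | ∃ t, bad ω t} := by
  rw [Set.ofPred_exists]
  exact .iUnion h

lemma measurableSet_firstBadFrom (h : ∀ t, MeasurableSet {ω | bad ω t}) (j : ℕ) :
    MeasurableSet {ω | FirstBadFrom (bad ω) j} := by
  refine MeasurableSet.inter ?_ (measurableSet_exists_bad h)
  change MeasurableSet {ω | ∀ i < j, ¬ bad ω i}
  simp only [Set.ofPred_forall]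
  exact .iInter fun i => .iInter fun _ => (h i).compl

lemma measurable_everBad (h : ∀ t, MeasurableSet {ω | bad ω t}) :
    Measurable fun ω => everBad (bad ω) :=
  Measurable.ite (measurableSet_exists_bad h) measurable_const measurable_const

lemma measurable_stepsAfterFirstBad (h : ∀ t, MeasurableSet {ω | bad ω t}) :
    Measurable fun ω => stepsAfterFirstBad (bad ω) :=
  Measurable.tsum fun j =>
    Measurable.ite (measurableSet_firstBadFrom h j) measurable_const measurable_const

end FirstBad

namespace POMC

/-! ### A past in front of a future run -/

section Prepend

variable {S : Type*}

/-- The run that starts with the states in the list `w` and goes on with `ρ`. -/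
def prepend : List S → (ℕ → S) → ℕ → S
  | [], ρ => ρ
  | s :: w, ρ => cons s (prepend w ρ)

lemma prepend_append_singleton (w : List S) (s : S) (ρ : ℕ → S) :
    prepend (w ++ [s]) ρ = prepend w (cons s ρ) := by
  induction w with
  | nil => rfl
  | cons t w ih => simp only [List.cons_append, prepend, ih]

lemma measurable_prepend [MeasurableSpace S] (w : List S) : Measurable (prepend w) := by
  induction w with
  | nil => exact measurable_id
  | cons s w ih => exact (measurable_cons s).comp ih

lemma map_range_prepend {T : Type*} (g : S → T) (w : List S) (ρ : ℕ → S) :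
    (List.range (w.length + 1)).map (fun i => g (prepend w ρ i)) = w.map g ++ [g (ρ 0)] := by
  induction w with
  | nil => simp [prepend]
  | cons s w ih =>
    rw [List.length_cons, List.range_succ_eq_map]
    simp only [List.map_cons, List.map_map, List.cons_append]
    rw [← ih]
    rfl

end Prepend

lemma PMF_tsum_map {α β : Type*} (p : PMF α) (f : α → β) (g : β → ℝ≥0∞) :
    ∑' b, p.map f b * g b = ∑' a, p a * g (f a) := by
  classical
  simp only [PMF.map_apply, ← ENNReal.tsum_mul_right]
  rw [ENNReal.tsum_comm]
  refine tsum_congr fun a => ?_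
  rw [tsum_eq_single (f a)]
  · simp
  · intro b hb
    simp [hb]

/-! ### From the induced chain to a recursion over phases -/

section Phases

variable {k : ℕ} {S : Type*} (M : POMC S (Set (Marker k)))

/-- At time `t`, the end of a block, the second half of the path executed is not good. -/
def BadAt (F : ℕ) (ω : ℕ → S) (t : ℕ) : Prop :=
  2 * F ∣ t ∧ ¬ GoodPath (secondHalf ((List.range (t + 1)).map fun i => M.obs (ω i)))

lemma decidedBy_badAt (F t : ℕ) : DecidedBy t {ω | M.BadAt F ω t} := by
  rintro ω ω' h ⟨h1, h2⟩
  refine ⟨h1, ?_⟩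
  have : (List.range (t + 1)).map (fun i => M.obs (ω' i)) =
      (List.range (t + 1)).map fun i => M.obs (ω i) :=
    List.map_congr_left fun i hi => by rw [h i (Nat.lt_succ_iff.1 (List.mem_range.1 hi))]
  rwa [this]

/-- The states visited since the last restart, without the current one. -/
def phaseStates (h : History S RestartAction) : List S :=
  (h.past.rtakeWhile fun p => p.2 = RestartAction.cont).map Prod.fst

/-- The number of the current phase. -/
def phaseNumber (h : History S RestartAction) : ℕ :=
  (h.past.map Prod.snd).count RestartAction.restart + 1

/-- Turns the decision of the strategy into an event about runs of the original chain: the states of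
the current phase are put in front of an arbitrary continuation `ρ`, and only `ρ 0` matters for the
present decision. -/
lemma restartStrategy_eq_restart_iff (f : ℕ → ℕ) (h : History S RestartAction) {ρ : ℕ → S}
    (hρ : ρ 0 = h.last) :
    restartStrategy f (h.past.map fun p => (M.obs p.1, p.2)) (M.obs h.last) =
        RestartAction.restart ↔
      M.BadAt (f (phaseNumber h)) (prepend (phaseStates h) ρ) (phaseStates h).length := by
  have h1 : ((h.past.map fun p => (M.obs p.1, p.2)).rtakeWhile
      fun p => p.2 = RestartAction.cont).map Prod.fst = (phaseStates h).map M.obs := by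
    simp only [phaseStates, List.rtakeWhile, ← List.map_reverse, List.takeWhile_map, List.map_map]
    rfl
  have h2 : ((h.past.map fun p => (M.obs p.1, p.2)).map Prod.snd).count RestartAction.restart + 1 =
      phaseNumber h := by
    simp only [phaseNumber, List.map_map]
    rfl
  have h3 := map_range_prepend M.obs (phaseStates h) ρ
  rw [hρ] at h3
  have key : ∀ (p q : Prop) (_ : Decidable p), (p ↔ q) →
      ((if p then RestartAction.restart else RestartAction.cont) = RestartAction.restart ↔ q) := by
    intro p q _ hpq
    split_ifs with hp
    · exact ⟨fun _ => hpq.1 hp, fun _ => rfl⟩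
    · exact ⟨fun h' => by simp at h', fun h' => absurd (hpq.2 h') hp⟩
  rw [restartStrategy]
  refine key _ _ _ ?_
  rw [h1, h2, BadAt, h3]
  simp only [List.length_append, List.length_map, List.length_singleton, Nat.add_sub_cancel]

/-- The histories whose last action is a restart. -/
def restarted (S : Type*) : Set (History S RestartAction) :=
  {h | ∃ l s, h.past = l ++ [(s, RestartAction.restart)]}

lemma mem_restarted (l : List (S × RestartAction)) (s t : S) :
    (⟨l ++ [(s, RestartAction.restart)], t⟩ : History S RestartAction) ∈ restarted S :=
  ⟨l, s, rfl⟩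

lemma notMem_restarted (l : List (S × RestartAction)) (s t : S) :
    (⟨l ++ [(s, RestartAction.cont)], t⟩ : History S RestartAction) ∉ restarted S := by
  rintro ⟨l', s', h⟩
  have := (List.append_inj' h rfl).2
  simp at this

lemma phaseStates_restart (l : List (S × RestartAction)) (s t : S) :
    phaseStates ⟨l ++ [(s, RestartAction.restart)], t⟩ = [] := by
  simp [phaseStates, List.rtakeWhile]

lemma phaseStates_cont (l : List (S × RestartAction)) (s t t' : S) :
    phaseStates ⟨l ++ [(s, RestartAction.cont)], t⟩ = phaseStates ⟨l, t'⟩ ++ [s] := by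
  simp [phaseStates, List.rtakeWhile]

lemma phaseNumber_restart (l : List (S × RestartAction)) (s t t' : S) :
    phaseNumber ⟨l ++ [(s, RestartAction.restart)], t⟩ = phaseNumber ⟨l, t'⟩ + 1 := by
  simp [phaseNumber]

lemma phaseNumber_cont (l : List (S × RestartAction)) (s t t' : S) :
    phaseNumber ⟨l ++ [(s, RestartAction.cont)], t⟩ = phaseNumber ⟨l, t'⟩ := by
  simp [phaseNumber]

variable [Countable S] [MeasurableSpace S] [DiscreteMeasurableSpace S]

/-- The probability of a restart in a phase with block length `2 F`. -/
noncomputable def restartProb (F : ℕ) : ℝ≥0∞ :=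
  ∫⁻ ρ, everBad (M.BadAt F ρ) ∂M.runMeasure M.init

/-- The expected number of steps of a phase with block length `2 F`, counted only if the phase is
finite. -/
noncomputable def phaseCost (F : ℕ) : ℝ≥0∞ :=
  ∫⁻ ρ, stepsAfterFirstBad (M.BadAt F ρ) ∂M.runMeasure M.init

/-- If a phase with `n - 1` earlier restarts costs at most `Val n` in total, by the recursion over
phases, then so does the whole run. -/
theorem expectedSteps_le (f : ℕ → ℕ) (Val : ℕ → ℝ≥0∞)
    (hVal : ∀ n, 1 ≤ n → M.phaseCost (f n) + M.restartProb (f n) * Val (n + 1) ≤ Val n) :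
    M.expectedSteps f ≤ Val 1 := by
  classical
  -- The event that the current phase is ended `t` steps from now, if the original chain continues
  -- as `ρ`.
  set bad : History S RestartAction → (ℕ → S) → ℕ → Prop := fun h ρ t =>
    M.BadAt (f (phaseNumber h)) (prepend (phaseStates h) ρ) ((phaseStates h).length + t) with hbad
  have hmeas : ∀ h t, MeasurableSet {ρ | bad h ρ t} := fun h t =>
    measurable_prepend (phaseStates h) (M.decidedBy_badAt _ _).measurableSet
  set u : History S RestartAction → ℝ≥0∞ := fun h =>
    ∫⁻ ρ, everBad (bad h ρ) ∂M.runMeasure h.last with hu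
  -- Remaining cost of the current phase, plus the probability that it ends times the value of the
  -- next phase.
  set V : History S RestartAction → ℝ≥0∞ := fun h =>
    ∫⁻ ρ, stepsAfterFirstBad (bad h ρ) ∂M.runMeasure h.last + u h * Val (phaseNumber h + 1) with hV
  set N := M.restartMDP.induced (restartStrategy f) with hN
  have hbad0 : ∀ h ρ, ρ 0 = h.last → (bad h ρ 0 ↔
      restartStrategy f (h.past.map fun p => (M.obs p.1, p.2)) (M.obs h.last) =
        RestartAction.restart) := by
    intro h ρ hρ
    rw [M.restartStrategy_eq_restart_iff f h hρ]
    rfl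
  have hsr : ∀ h, restartStrategy f (h.past.map fun p => (M.obs p.1, p.2)) (M.obs h.last) =
      RestartAction.restart → ∀ g : History S RestartAction → ℝ≥0∞, ∑' t, N.step h t * g t =
        g ⟨h.past ++ [(h.last, RestartAction.restart)], M.init⟩ := by
    intro h hr g
    have : N.step h = (PMF.pure M.init).map
        fun s' => ⟨h.past ++ [(h.last, RestartAction.restart)], s'⟩ := by
      simp only [hN, POMDP.induced, restartMDP, hr]
    rw [this, PMF_tsum_map, tsum_eq_single M.init]
    · simp
    · intro b hb
      simp [hb]
  have hsc : ∀ h, restartStrategy f (h.past.map fun p => (M.obs p.1, p.2)) (M.obs h.last) ≠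
      RestartAction.restart → ∀ g : History S RestartAction → ℝ≥0∞, ∑' t, N.step h t * g t =
        ∑' s, M.step h.last s * g ⟨h.past ++ [(h.last, RestartAction.cont)], s⟩ := by
    intro h hr g
    have hr' : restartStrategy f (h.past.map fun p => (M.obs p.1, p.2)) (M.obs h.last) =
        RestartAction.cont := by
      cases hx : restartStrategy f (h.past.map fun p => (M.obs p.1, p.2)) (M.obs h.last)
      · exact absurd hx hr
      · rfl
    have : N.step h = (M.step h.last).map
        fun s' => ⟨h.past ++ [(h.last, RestartAction.cont)], s'⟩ := by
      simp only [hN, POMDP.induced, restartMDP, hr']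
    rw [this, PMF_tsum_map]
  have hbadc : ∀ (h : History S RestartAction) (s : S) ρ t,
      bad ⟨h.past ++ [(h.last, RestartAction.cont)], s⟩ ρ t ↔
        bad h (cons h.last ρ) (t + 1) := by
    intro h s ρ t
    simp only [hbad, phaseStates_cont h.past h.last s h.last,
      phaseNumber_cont h.past h.last s h.last, prepend_append_singleton, List.length_append,
      List.length_singleton]
    rw [add_assoc, add_comm 1 t]
  have hbadr : ∀ (h : History S RestartAction) ρ,
      bad ⟨h.past ++ [(h.last, RestartAction.restart)], M.init⟩ ρ =
        M.BadAt (f (phaseNumber h + 1)) ρ := by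
    intro h ρ
    ext t
    simp only [hbad, phaseStates_restart h.past h.last M.init,
      phaseNumber_restart h.past h.last M.init h.last, prepend, List.length_nil, zero_add]
  have hu1 : ∀ h, restartStrategy f (h.past.map fun p => (M.obs p.1, p.2)) (M.obs h.last) =
      RestartAction.restart → u h = 1 := by
    intro h hr
    have : ∀ᵐ ρ ∂M.runMeasure h.last, everBad (bad h ρ) = 1 := by
      filter_upwards [M.ae_zero_eq h.last] with ρ hρ
      exact everBad_of_zero ((hbad0 h ρ hρ).2 hr)
    simp [hu, lintegral_congr_ae this]
  have hu2 : ∀ h, restartStrategy f (h.past.map fun p => (M.obs p.1, p.2)) (M.obs h.last) ≠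
      RestartAction.restart →
      u h = ∑' s, M.step h.last s * u ⟨h.past ++ [(h.last, RestartAction.cont)], s⟩ := by
    intro h hr
    simp only [hu]
    rw [M.lintegral_runMeasure _ (measurable_everBad (hmeas h))]
    refine tsum_congr fun s => ?_
    congr 1
    refine lintegral_congr fun ρ => ?_
    rw [everBad_of_not_zero (mt (hbad0 h (cons h.last ρ) rfl).1 hr)]
    congr 1
    ext t
    exact (hbadc h s ρ t).symm
  have key := N.lintegral_lastVisit_le (restarted S) u V ?_ ?_ N.init
  · refine key.trans ?_
    have : V N.init = M.phaseCost (f 1) + M.restartProb (f 1) * Val (1 + 1) := by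
      simp [hV, hu, hbad, hN, POMDP.induced, restartMDP, phaseStates, phaseNumber, prepend,
        phaseCost, restartProb, List.rtakeWhile]
    rw [this]
    exact hVal 1 le_rfl
  · intro h
    by_cases hr : restartStrategy f (h.past.map fun p => (M.obs p.1, p.2)) (M.obs h.last) =
      RestartAction.restart
    · rw [hsr h hr, hu1 h hr, if_pos (mem_restarted _ _ _)]
    · rw [hsc h hr, hu2 h hr]
      refine le_of_eq (tsum_congr fun s => ?_)
      rw [if_neg (notMem_restarted _ _ _)]
  · intro h
    by_cases hr : restartStrategy f (h.past.map fun p => (M.obs p.1, p.2)) (M.obs h.last) =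
      RestartAction.restart
    · rw [hsr h hr, hu1 h hr]
      have h1 : V h = 1 + Val (phaseNumber h + 1) := by
        have : ∀ᵐ ρ ∂M.runMeasure h.last, stepsAfterFirstBad (bad h ρ) = 1 := by
          filter_upwards [M.ae_zero_eq h.last] with ρ hρ
          exact stepsAfterFirstBad_of_zero ((hbad0 h ρ hρ).2 hr)
        simp only [hV, hu1 h hr, one_mul, lintegral_congr_ae this]
        simp
      rw [h1]
      gcongr
      simp only [hV, hu, hbadr, phaseNumber_restart h.past h.last M.init h.last]
      exact hVal _ (by omega)
    · rw [hsc h hr]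
      simp only [hV]
      simp only [mul_add, ENNReal.tsum_add, phaseNumber_cont h.past h.last _ h.last, ← mul_assoc,
        ENNReal.tsum_mul_right]
      rw [← hu2 h hr, ← add_assoc]
      gcongr
      refine le_of_eq ?_
      have h1 : ∀ s, ∫⁻ ρ, stepsAfterFirstBad (bad h (cons h.last ρ)) ∂M.runMeasure s =
          ∫⁻ ρ, everBad (bad h (cons h.last ρ)) ∂M.runMeasure s + ∫⁻ ρ, stepsAfterFirstBad
            (bad ⟨h.past ++ [(h.last, RestartAction.cont)], s⟩ ρ) ∂M.runMeasure s := by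
        intro s
        rw [← lintegral_add_left (f := fun ρ => everBad (bad h (cons h.last ρ)))
          ((measurable_everBad (hmeas h)).comp (measurable_cons h.last))]
        refine lintegral_congr fun ρ => ?_
        rw [stepsAfterFirstBad_of_not_zero (mt (hbad0 h (cons h.last ρ) rfl).1 hr)]
        congr 2
        ext t
        exact (hbadc h s ρ t).symm
      rw [M.lintegral_runMeasure _ (measurable_stepsAfterFirstBad (hmeas h))]
      simp only [h1, mul_add, ENNReal.tsum_add]
      rw [← M.lintegral_runMeasure _ (measurable_everBad (hmeas h))]

end Phases

/-! ### Bottom components, paths and radii -/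

section Graph

variable {S O : Type*} (M : POMC S O)

variable {M} in
lemma IsBSCC.reach_mem {B : Set S} (h : M.IsBSCC B) {s t : S} (hs : s ∈ B) (hst : M.Reach s t) :
    t ∈ B := by
  induction hst with
  | refl => exact hs
  | tail _ he ih => exact h.2 _ ih _ he

variable {M} in
lemma IsBSCC.eq_of_mem {B B' : Set S} (h : M.IsBSCC B) (h' : M.IsBSCC B') {s : S} (hs : s ∈ B)
    (hs' : s ∈ B') : B = B' := by
  refine Set.Subset.antisymm (fun t ht => ?_) fun t ht => ?_
  · exact h'.reach_mem hs' (h.1.prop.2 s hs t ht)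
  · exact h.reach_mem hs (h'.1.prop.2 s hs' t ht)

/-- Among the states reachable from `s`, take `t` with the fewest reachable states. Whatever `t`
reaches has the same reachable set, hence leads back to `t`, so the set reachable from `t` is a
bottom component. -/
lemma exists_isBSCC_of_reach [Finite S] (s : S) : ∃ B t, M.IsBSCC B ∧ t ∈ B ∧ M.Reach s t := by
  obtain ⟨t, ht, hmin⟩ := Set.exists_min_image {t | M.Reach s t} (fun t => {u | M.Reach t u}.ncard)
    (Set.toFinite _) ⟨s, Relation.ReflTransGen.refl⟩
  have hback : ∀ u, M.Reach t u → M.Reach u t := by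
    intro u hu
    have hsub : {v | M.Reach u v} ⊆ {v | M.Reach t v} := fun v hv => Relation.ReflTransGen.trans hu hv
    have heq := Set.eq_of_subset_of_ncard_le hsub
      (hmin u (Relation.ReflTransGen.trans ht hu)) (Set.toFinite _)
    have : t ∈ {v | M.Reach t v} := Relation.ReflTransGen.refl
    rwa [← heq] at this
  refine ⟨{u | M.Reach t u}, t, ⟨⟨⟨⟨t, Relation.ReflTransGen.refl⟩, fun u hu v hv =>
    Relation.ReflTransGen.trans (hback u hu) hv⟩, ?_⟩, fun u hu v huv => ?_⟩,
    Relation.ReflTransGen.refl, ht⟩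
  · intro B hB hle u hu
    exact hB.2 t (hle Relation.ReflTransGen.refl) u hu
  · exact Relation.ReflTransGen.tail hu huv

lemma exists_edge (s : S) : ∃ t, M.Edge s t := by
  obtain ⟨t, ht⟩ := (M.step s).support_nonempty
  exact ⟨t, pos_iff_ne_zero.2 ((PMF.mem_support_iff _ _).1 ht)⟩

variable {M} in
lemma IsPath.cons {s : S} {π : ℕ → S} {m : ℕ} (h : M.IsPath π m) (he : M.Edge s (π 0)) :
    M.IsPath (cons s π) (m + 1) := by
  intro n hn
  cases n with
  | zero => exact he
  | succ n => exact h n (by omega)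

lemma exists_path_of_reach {s t : S} (h : M.Reach s t) :
    ∃ (π : ℕ → S) (m : ℕ), π 0 = s ∧ π m = t ∧ M.IsPath π m := by
  induction h using Relation.ReflTransGen.head_induction_on with
  | refl => exact ⟨fun _ => t, 0, rfl, rfl, fun n hn => absurd hn (Nat.not_lt_zero n)⟩
  | head he _ ih =>
    obtain ⟨π, m, h0, hm, hp⟩ := ih
    exact ⟨POMC.cons _ π, m + 1, rfl, hm, hp.cons (by rwa [h0])⟩

variable {M} in
lemma IsPath.reach {π : ℕ → S} {m : ℕ} (h : M.IsPath π m) {i : ℕ} (hi : i ≤ m) :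
    M.Reach (π 0) (π i) := by
  induction i with
  | zero => exact Relation.ReflTransGen.refl
  | succ i ih => exact (ih (by omega)).tail (h i (by omega))

lemma reach_of_edges {ρ : ℕ → S} (h : ∀ n, M.Edge (ρ n) (ρ (n + 1))) {i j : ℕ} (hij : i ≤ j) :
    M.Reach (ρ i) (ρ j) := by
  induction j, hij using Nat.le_induction with
  | base => exact Relation.ReflTransGen.refl
  | succ j _ ih => exact ih.tail (h j)

/-- Paths can be concatenated, so a path can be prolonged until it visits further states. -/
lemma exists_path_append {π : ℕ → S} {m : ℕ} (h : M.IsPath π m) {t : S}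
    (ht : M.Reach (π m) t) : ∃ (π' : ℕ → S) (m' : ℕ), m ≤ m' ∧ M.IsPath π' m' ∧
      (∀ i ≤ m, π' i = π i) ∧ π' m' = t := by
  obtain ⟨σ, l, h0, hl, hσ⟩ := M.exists_path_of_reach ht
  refine ⟨fun i => if i ≤ m then π i else σ (i - m), m + l, by omega, ?_, ?_, ?_⟩
  · intro n hn
    dsimp only
    rcases lt_trichotomy n m with hnm | rfl | hnm
    · rw [if_pos (by omega), if_pos (by omega)]
      exact h n hnm
    · rw [if_pos le_rfl, if_neg (by omega), ← h0, show n + 1 - n = 0 + 1 by omega]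
      exact hσ 0 (by omega)
    · rw [if_neg (by omega), if_neg (by omega), show n + 1 - m = n - m + 1 by omega]
      exact hσ _ (by omega)
  · intro i hi
    simp [hi]
  · dsimp only
    split_ifs with hlm
    · obtain rfl : l = 0 := by omega
      rw [← hl, h0, add_zero]
    · rw [← hl]; congr 1; omega

/-- For a class of paths, there is one that starts in `s` and whose length is at most the radius. -/
lemma exists_le_radius [Finite S] {prog : (ℕ → S) → ℕ → Prop} {X : Set S}
    (h : ∀ s ∈ X, ∃ (π : ℕ → S) (m : ℕ), π 0 = s ∧ prog π m) {s : S} (hs : s ∈ X) :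
    ∃ m ≤ radius prog X, ∃ π : ℕ → S, π 0 = s ∧ prog π m := by
  have hne : {m | ∃ π : ℕ → S, π 0 = s ∧ prog π m}.Nonempty := by
    obtain ⟨π, m, h1, h2⟩ := h s hs
    exact ⟨m, π, h1, h2⟩
  refine ⟨_, ?_, Nat.sInf_mem hne⟩
  exact le_csSup ((Set.toFinite X).image _).bddAbove (Set.mem_image_of_mem _ hs)

end Graph

/-! ### Windows without progress -/

section Progress

variable {S O : Type*} (M : POMC S O) {prog : (ℕ → S) → ℕ → Prop}

/-- The runs without a path of the class `prog` up to time `R`. -/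
def noProgress (prog : (ℕ → S) → ℕ → Prop) (R : ℕ) : Set (ℕ → S) :=
  {ρ | ¬ ∃ a m, a + m ≤ R ∧ prog (shift a ρ) m}

lemma noProgress_anti {R R' : ℕ} (h : R ≤ R') : noProgress prog R' ⊆ noProgress prog R :=
  fun _ hρ ⟨a, m, ham, hp⟩ => hρ ⟨a, m, ham.trans h, hp⟩

lemma shift_mem_noProgress {a R R' : ℕ} {ρ : ℕ → S} (h : ρ ∈ noProgress prog R') (ha : a + R ≤ R') :
    shift a ρ ∈ noProgress prog R := by
  rintro ⟨b, m, hbm, hp⟩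
  refine h ⟨a + b, m, by omega, ?_⟩
  rwa [shift_shift] at hp

/-- Whether a finite path is in the class `prog` depends only on the path. -/
def IsLocal (prog : (ℕ → S) → ℕ → Prop) : Prop :=
  ∀ (π π' : ℕ → S) (m : ℕ), (∀ i ≤ m, π i = π' i) → prog π m → prog π' m

lemma IsLocal.decidedBy_noProgress (h : IsLocal prog) (R : ℕ) :
    DecidedBy R (noProgress prog R) := by
  rintro ρ ρ' hρ hn ⟨a, m, ham, hp⟩
  exact hn ⟨a, m, ham, h _ _ m (fun i hi => (hρ (a + i) (by omega)).symm) hp⟩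

variable [Finite S] [MeasurableSpace S] [DiscreteMeasurableSpace S]

/-- The cylinder of a short witness path already has positive probability, and the infimum over a
finite nonempty set is attained. -/
lemma prob_pos (hloc : IsLocal prog) (hpath : ∀ π m, prog π m → M.IsPath π m) {X : Set S} {r : ℕ}
    (h : ∀ s ∈ X, ∃ m ≤ r, ∃ π : ℕ → S, π 0 = s ∧ prog π m) : 0 < M.prob prog X r := by
  classical
  have hs : ∀ s ∈ X, 0 < M.runMeasure s {ρ | ∃ a m, a + m ≤ r ∧ prog (fun n => ρ (a + n)) m} := by
    intro s hs
    obtain ⟨m, hm, π, h0, hp⟩ := h s hs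
    have hsub : cylinder m π ⊆ {ρ | ∃ a m, a + m ≤ r ∧ prog (fun n => ρ (a + n)) m} := by
      intro ρ hρ
      exact ⟨0, m, by omega, hloc π _ m (fun i hi => by simp [hρ i hi]) hp⟩
    refine lt_of_lt_of_le ?_ (measure_mono hsub)
    rw [runMeasure_cylinder, if_pos h0, pos_iff_ne_zero, Finset.prod_ne_zero_iff]
    intro i hi
    exact (hpath π m hp i (Finset.mem_range.1 hi)).ne'
  rw [prob]
  rcases X.eq_empty_or_nonempty with rfl | hne
  · simp
  · obtain ⟨t, ht, hmin⟩ := Set.exists_min_image X (fun s => M.runMeasure s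
      {ρ | ∃ a m, a + m ≤ r ∧ prog (fun n => ρ (a + n)) m}) (Set.toFinite _) hne
    exact lt_of_lt_of_le (hs t ht) (le_iInf₂ hmin)

lemma prob_le_one {X : Set S} (hX : X.Nonempty) (r : ℕ) : M.prob prog X r ≤ 1 := by
  obtain ⟨s, hs⟩ := hX
  exact (iInf₂_le s hs).trans MeasureTheory.prob_le_one

/-- A window in which no progress is made, although progress is possible, is unlikely. -/
lemma runMeasure_noProgress_le (hloc : IsLocal prog) {X : Set S} {r R : ℕ} (hr : r ≤ R)
    {P : ℝ≥0∞} (hP : P ≤ M.prob prog X r) (s : S) :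
    M.runMeasure s ({ρ | ρ 0 ∈ X} ∩ noProgress prog R) ≤ 1 - P := by
  by_cases hs : s ∈ X
  · have hm := (hloc.decidedBy_noProgress R).measurableSet
    have h1 : M.runMeasure s (noProgress prog R)ᶜ ≥ P := by
      refine (hP.trans (iInf₂_le s hs)).trans (measure_mono ?_)
      rintro ρ ⟨a, m, ham, hp⟩
      simp only [noProgress, Set.mem_compl_iff, Set.mem_ofPred_eq, not_not]
      exact ⟨a, m, ham.trans hr, hp⟩
    calc M.runMeasure s ({ρ | ρ 0 ∈ X} ∩ noProgress prog R)
        ≤ M.runMeasure s (noProgress prog R) := measure_mono Set.inter_subset_right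
      _ = 1 - M.runMeasure s (noProgress prog R)ᶜ := by
        have := prob_compl_eq_one_sub (μ := M.runMeasure s) hm.compl
        rwa [compl_compl] at this
      _ ≤ 1 - P := by gcongr
  · have : M.runMeasure s ({ρ | ρ 0 ∈ X} ∩ noProgress prog R) = 0 := by
      refine measure_eq_zero_iff_ae_notMem.2 ?_
      filter_upwards [M.ae_zero_eq s] with ρ h hρ
      exact hs (h ▸ hρ.1)
    rw [this]
    exact zero_le

end Progress

/-! ### Existence of progress paths; positivity of the radius and the probability -/

section Markers

variable {k : ℕ} {S : Type*} (M : POMC S (Set (Marker k)))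

lemma isLocal_goodProgress : IsLocal M.GoodProgress := by
  rintro π π' m h ⟨hm, hp, hd⟩
  refine ⟨hm, fun n hn => ?_, ?_⟩
  · rw [← h n (by omega), ← h (n + 1) (by omega)]
    exact hp n hn
  · rwa [← h 0 (by omega), ← h m le_rfl]

lemma isLocal_badProgress (v : ℕ) : IsLocal (M.BadProgress v) := by
  rintro π π' m h ⟨hm, hp, hd⟩
  refine ⟨hm, fun n hn => ?_, ?_⟩
  · rw [← h n (by omega), ← h (n + 1) (by omega)]
    exact hp n hn
  · rw [← h 0 (by omega), ← h m le_rfl]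
    refine hd.imp_right ?_
    rintro ⟨B, h1, h2, h3, h4⟩
    refine ⟨B, h1, h2, h3, fun i hi => ?_⟩
    obtain ⟨n, hv, hn, hf⟩ := h4 i hi
    exact ⟨n, hv, hn, h n hn ▸ hf⟩

lemma reach_goodBottom {s t : S} (hs : s ∈ M.goodBottom) (h : M.Reach s t) : t ∈ M.goodBottom := by
  obtain ⟨B, hB, hsB, hg⟩ := hs
  exact ⟨B, hB, hB.reach_mem hsB h, hg⟩

lemma reach_badBottom {s t : S} (hs : s ∈ M.badBottom) (h : M.Reach s t) : t ∈ M.badBottom := by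
  obtain ⟨B, hB, hsB, hg⟩ := hs
  exact ⟨B, hB, hB.reach_mem hsB h, hg⟩

lemma canReach_good_or_bad [Finite S] (s : S) :
    s ∈ M.canReach M.goodBottom ∨ s ∈ M.canReach M.badBottom := by
  obtain ⟨B, t, hB, ht, hst⟩ := M.exists_isBSCC_of_reach s
  by_cases hg : ∃ i, M.IsGoodFor i B
  · exact Or.inl ⟨t, ⟨B, hB, ht, hg⟩, hst⟩
  · exact Or.inr ⟨t, ⟨B, hB, ht, hg⟩, hst⟩

lemma exists_path_to {X : Set S} {s : S} (hs : s ∈ M.canReach X \ X) :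
    ∃ (π : ℕ → S) (m : ℕ), π 0 = s ∧ 0 < m ∧ M.IsPath π m ∧ π m ∈ X := by
  obtain ⟨⟨t, ht, hst⟩, hX⟩ := hs
  obtain ⟨π, m, h0, hm, hp⟩ := M.exists_path_of_reach hst
  refine ⟨π, m, h0, Nat.pos_of_ne_zero ?_, hp, hm ▸ ht⟩
  rintro rfl
  exact hX (h0 ▸ hm ▸ ht)

lemma exists_goodProgress_of_transient {s : S} (hs : s ∈ M.canReach M.goodBottom \ M.goodBottom) :
    ∃ (π : ℕ → S) (m : ℕ), π 0 = s ∧ M.GoodProgress π m := by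
  obtain ⟨π, m, h0, hm, hp, h⟩ := M.exists_path_to hs
  exact ⟨π, m, h0, hm, hp, Or.inl ⟨h0 ▸ hs, h⟩⟩

lemma exists_badProgress_of_transient (v : ℕ) {s : S}
    (hs : s ∈ M.canReach M.badBottom \ M.badBottom) :
    ∃ (π : ℕ → S) (m : ℕ), π 0 = s ∧ M.BadProgress v π m := by
  obtain ⟨π, m, h0, hm, hp, h⟩ := M.exists_path_to hs
  exact ⟨π, m, h0, hm, hp, Or.inl ⟨h0 ▸ hs, h⟩⟩

/-- One edge is taken before walking to the marker, so the length is positive even if `s` carries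
the marker itself. -/
lemma exists_goodProgress_of_bottom {s : S} (hs : s ∈ M.goodBottom) :
    ∃ (π : ℕ → S) (m : ℕ), π 0 = s ∧ M.GoodProgress π m := by
  obtain ⟨B, hB, hsB, i, hi⟩ := hs
  obtain ⟨t, ht, hti⟩ := hi.1
  obtain ⟨s', hs'⟩ := M.exists_edge s
  obtain ⟨π, m, h0, hm, hp⟩ := M.exists_path_of_reach (hB.1.prop.2 s' (hB.2 s hsB s' hs') t ht)
  exact ⟨cons s π, m + 1, rfl, Nat.succ_pos m, hp.cons (by rwa [h0]),
    Or.inr ⟨B, i, hB, hsB, hi, by rw [cons_succ, hm]; exact hti⟩⟩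

/-- A bad component that contains `e_i` also contains `f_i`, so strong connectivity gives a path
that visits the required markers one after another. It is preceded by one edge, so that all visits
have index at least 1 and count under both conventions. -/
lemma exists_badProgress_of_bottom {v : ℕ} (hv : v ≤ 1) {s : S} (hs : s ∈ M.badBottom) :
    ∃ (π : ℕ → S) (m : ℕ), π 0 = s ∧ M.BadProgress v π m := by
  classical
  obtain ⟨B, hB, hsB, hg⟩ := hs
  obtain ⟨s', hs'⟩ := M.exists_edge s
  have hs'B := hB.2 s hsB s' hs'
  have key : ∀ I : Finset (Fin k), ∃ (π : ℕ → S) (m : ℕ), π 0 = s' ∧ M.IsPath π m ∧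
      ∀ i ∈ I, (∃ t ∈ B, Marker.e i ∈ M.obs t) → ∃ n ≤ m, Marker.f i ∈ M.obs (π n) := by
    intro I
    induction I using Finset.induction_on with
    | empty => exact ⟨fun _ => s', 0, rfl, fun n hn => absurd hn (Nat.not_lt_zero n), by simp⟩
    | insert i I _ ih =>
      obtain ⟨π, m, h0, hp, hI⟩ := ih
      by_cases hi : ∃ t ∈ B, Marker.e i ∈ M.obs t
      · have : ∃ t ∈ B, Marker.f i ∈ M.obs t := by
          by_contra hcon
          push Not at hcon
          exact hg ⟨i, hi, hcon⟩
        obtain ⟨t, ht, hti⟩ := this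
        have hπ : M.Reach (π m) t :=
          hB.1.prop.2 _ (hB.reach_mem (h0 ▸ hs'B) (hp.reach le_rfl)) t ht
        obtain ⟨π', m', hmm, hp', heq, hend⟩ := M.exists_path_append hp hπ
        refine ⟨π', m', by rw [heq 0 (by omega), h0], hp', fun j hj hjB => ?_⟩
        rcases Finset.mem_insert.1 hj with rfl | hj
        · exact ⟨m', le_rfl, hend ▸ hti⟩
        · obtain ⟨n, hn, hf⟩ := hI j hj hjB
          exact ⟨n, by omega, by rw [heq n hn]; exact hf⟩
      · refine ⟨π, m, h0, hp, fun j hj hjB => ?_⟩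
        rcases Finset.mem_insert.1 hj with rfl | hj
        · exact absurd hjB hi
        · exact hI j hj hjB
  obtain ⟨π, m, h0, hp, hI⟩ := key Finset.univ
  refine ⟨cons s π, m + 1, rfl, Nat.succ_pos m, hp.cons (by rwa [h0]),
    Or.inr ⟨B, hB, hsB, hg, fun i hi => ?_⟩⟩
  obtain ⟨n, hn, hf⟩ := hI i (Finset.mem_univ i) hi
  exact ⟨n + 1, by omega, by omega, hf⟩

/-- Some bottom component exists, and progress paths have positive length. -/
lemma Rm_pos [Finite S] {v : ℕ} (hv : v ≤ 1) : 0 < M.Rm v := by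
  rcases M.canReach_good_or_bad M.init with ⟨t, ht, -⟩ | ⟨t, ht, -⟩
  · obtain ⟨m, hm, π, -, h⟩ :=
      exists_le_radius (fun _ => M.exists_goodProgress_of_bottom) ht
    exact h.1.trans_le (hm.trans ((le_max_right _ _).trans (le_max_left _ _)))
  · obtain ⟨m, hm, π, -, h⟩ :=
      exists_le_radius (fun _ => M.exists_badProgress_of_bottom hv) ht
    exact h.1.trans_le (hm.trans ((le_max_right _ _).trans (le_max_right _ _)))

variable [Finite S] [MeasurableSpace S] [DiscreteMeasurableSpace S]

lemma Pm_pos {v : ℕ} (hv : v ≤ 1) : 0 < M.Pm v := by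
  refine lt_min (lt_min ?_ ?_) (lt_min ?_ ?_)
  · exact M.prob_pos M.isLocal_goodProgress (fun _ _ h => h.2.1) fun s hs =>
      exists_le_radius (fun _ => M.exists_goodProgress_of_transient) hs
  · exact M.prob_pos M.isLocal_goodProgress (fun _ _ h => h.2.1) fun s hs =>
      exists_le_radius (fun _ => M.exists_goodProgress_of_bottom) hs
  · exact M.prob_pos (M.isLocal_badProgress v) (fun _ _ h => h.2.1) fun s hs =>
      exists_le_radius (fun _ => M.exists_badProgress_of_transient v) hs
  · exact M.prob_pos (M.isLocal_badProgress v) (fun _ _ h => h.2.1) fun s hs =>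
      exists_le_radius (fun _ => M.exists_badProgress_of_bottom hv) hs

/-- At least one of the two sets of bottom states is nonempty; an empty range would contribute `⊤`.
-/
lemma Pm_le_one (v : ℕ) : M.Pm v ≤ 1 := by
  rcases M.canReach_good_or_bad M.init with ⟨t, ht, -⟩ | ⟨t, ht, -⟩
  · exact (min_le_left _ _).trans ((min_le_right _ _).trans (M.prob_le_one ⟨t, ht⟩ _))
  · exact (min_le_right _ _).trans ((min_le_right _ _).trans (M.prob_le_one ⟨t, ht⟩ _))

end Markers

lemma eq_zero_of_forall_le_half_pow {x : ℝ≥0∞} (h : ∀ k : ℕ, x ≤ 2⁻¹ ^ k) : x = 0 := by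
  refine le_antisymm (ge_of_tendsto' (ENNReal.tendsto_pow_atTop_nhds_zero_of_lt_one ?_) h) zero_le
  exact ENNReal.inv_lt_one.2 ENNReal.one_lt_two

section Ends

variable {k : ℕ} {S : Type*} (M : POMC S (Set (Marker k))) (v : ℕ)

lemma GoodProgress.end_mem {π : ℕ → S} {m : ℕ} (h : M.GoodProgress π m) : π m ∈ M.goodBottom := by
  obtain ⟨-, hp, h | ⟨B, i, hB, h0, hi, -⟩⟩ := h
  · exact h.2
  · exact ⟨B, hB, hB.reach_mem h0 (hp.reach le_rfl), i, hi⟩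

lemma BadProgress.end_mem {π : ℕ → S} {m : ℕ} (h : M.BadProgress v π m) : π m ∈ M.badBottom := by
  obtain ⟨-, hp, h | ⟨B, hB, h0, hi, -⟩⟩ := h
  · exact h.2
  · exact ⟨B, hB, hB.reach_mem h0 (hp.reach le_rfl), hi⟩

lemma decidedBy_at (X : Set S) (n : ℕ) : DecidedBy n {ρ : ℕ → S | ρ n ∈ X} := by
  intro ρ ρ' h hρ
  change ρ' n ∈ X
  rw [← h n le_rfl]
  exact hρ

end Ends

/-! ### Exponential bounds in multiples of the window -/

section Windows

variable {k : ℕ} {S : Type*} [Finite S] [MeasurableSpace S] [DiscreteMeasurableSpace S]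
  (M : POMC S (Set (Marker k))) (v : ℕ)

/-- A multiple of the progress radius, such that no progress is made in a window of this length
with probability at most `1 / 2`. -/
noncomputable def window : ℕ := M.Rm v * ⌈(M.Pm v).toReal⁻¹⌉₊

/-- From 1 - P ≤ exp(-P), the power is at most exp(-1) ≤ 1/2. -/
lemma one_sub_Pm_pow_le {v : ℕ} (hv : v ≤ 1) :
    (1 - M.Pm v) ^ ⌈(M.Pm v).toReal⁻¹⌉₊ ≤ 2⁻¹ := by
  have h1 := M.Pm_le_one v
  have hne : M.Pm v ≠ ∞ := ne_top_of_le_ne_top ENNReal.one_ne_top h1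
  set P := (M.Pm v).toReal with hP
  have hP0 : 0 < P := ENNReal.toReal_pos (M.Pm_pos hv).ne' hne
  have hP1 : P ≤ 1 := by
    have := ENNReal.toReal_mono ENNReal.one_ne_top h1
    simpa using this
  set q := ⌈P⁻¹⌉₊
  have hq : 1 ≤ P * q := by
    have := Nat.le_ceil P⁻¹
    calc 1 = P * P⁻¹ := (mul_inv_cancel₀ hP0.ne').symm
      _ ≤ P * q := by gcongr
  have hexp : (1 - P) ^ q ≤ 2⁻¹ := by
    calc (1 - P) ^ q ≤ Real.exp (-P) ^ q := by
          refine pow_le_pow_left₀ (by linarith) ?_ q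
          have := Real.add_one_le_exp (-P)
          linarith
      _ = Real.exp (-(P * q)) := by rw [← Real.exp_nat_mul]; ring_nf
      _ ≤ Real.exp (-1) := Real.exp_le_exp.2 (by linarith)
      _ ≤ 2⁻¹ := by
          rw [Real.exp_neg]
          gcongr
          have := Real.add_one_le_exp (1 : ℝ)
          linarith
  rw [← ENNReal.toReal_le_toReal (by finiteness) (by simp), ENNReal.toReal_pow,
    ENNReal.toReal_sub_of_le h1 ENNReal.one_ne_top]
  simpa using hexp

lemma one_sub_Pm_pow_mul_le {v : ℕ} (hv : v ≤ 1) (j : ℕ) :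
    (1 - M.Pm v) ^ (j * ⌈(M.Pm v).toReal⁻¹⌉₊) ≤ 2⁻¹ ^ j := by
  rw [mul_comm, pow_mul]
  gcongr
  exact M.one_sub_Pm_pow_le hv

/-- The windows are cut into blocks whose length is the progress radius. Since `X` is closed under
reachability, every block starts in `X`, so each of them independently of the past misses progress
with probability at most 1 - P_m. -/
lemma runMeasure_noProgress_window_le {v : ℕ} (hv : v ≤ 1) {prog : (ℕ → S) → ℕ → Prop}
    (hloc : IsLocal prog) {X : Set S} (hX : ∀ s ∈ X, ∀ t, M.Reach s t → t ∈ X) {r : ℕ}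
    (hr : r ≤ M.Rm v) (hP : M.Pm v ≤ M.prob prog X r) (j : ℕ) (s : S) :
    M.runMeasure s ({ρ | ρ 0 ∈ X} ∩ noProgress prog (j * M.window v)) ≤ 2⁻¹ ^ j := by
  set A : Set (ℕ → S) := {ρ | ρ 0 ∈ X} ∩ noProgress prog (M.Rm v) with hA
  have hAd : DecidedBy (M.Rm v) A := by
    rintro ρ ρ' h ⟨h1, h2⟩
    refine ⟨?_, hloc.decidedBy_noProgress _ _ _ h h2⟩
    change ρ' 0 ∈ X
    rw [← h 0 (Nat.zero_le _)]
    exact h1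
  refine le_trans ?_ ((M.runMeasure_iterate_le hAd (M.runMeasure_noProgress_le hloc hr hP)
    (j * ⌈(M.Pm v).toReal⁻¹⌉₊) s).trans (M.one_sub_Pm_pow_mul_le hv j))
  refine measure_mono_ae ?_
  filter_upwards [M.ae_isPath s] with ρ hρ hmem i hi
  refine ⟨hX _ hmem.1 _ (M.reach_of_edges hρ (Nat.zero_le _)), shift_mem_noProgress hmem.2 ?_⟩
  calc i * M.Rm v + M.Rm v = (i + 1) * M.Rm v := by ring
    _ ≤ (j * ⌈(M.Pm v).toReal⁻¹⌉₊) * M.Rm v := Nat.mul_le_mul_right _ hi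
    _ = j * M.window v := by rw [window]; ring

lemma runMeasure_noGoodProgress_le {v : ℕ} (hv : v ≤ 1) (j : ℕ) (s : S) :
    M.runMeasure s ({ρ | ρ 0 ∈ M.goodBottom} ∩ noProgress M.GoodProgress (j * M.window v)) ≤
      2⁻¹ ^ j :=
  M.runMeasure_noProgress_window_le hv M.isLocal_goodProgress
    (fun _ hs _ h => M.reach_goodBottom hs h) ((le_max_right _ _).trans (le_max_left _ _))
    ((min_le_left _ _).trans (min_le_right _ _)) j s

lemma runMeasure_noBadProgress_le {v : ℕ} (hv : v ≤ 1) (j : ℕ) (s : S) :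
    M.runMeasure s ({ρ | ρ 0 ∈ M.badBottom} ∩ noProgress (M.BadProgress v) (j * M.window v)) ≤
      2⁻¹ ^ j :=
  M.runMeasure_noProgress_window_le hv (M.isLocal_badProgress v)
    (fun _ hs _ h => M.reach_badBottom hs h) ((le_max_right _ _).trans (le_max_right _ _))
    ((min_le_right _ _).trans (min_le_right _ _)) j s

/-- A good progress path ends in a good component, which is never left; a run that is outside at the
end of the block has therefore made no progress in it. -/
lemma runMeasure_notMem_goodBottom_le {s : S} (hs : s ∈ M.canReach M.goodBottom \ M.goodBottom) :
    M.runMeasure s {ρ | ρ (M.Rm v) ∉ M.goodBottom} ≤ 1 - M.Pm v := by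
  refine le_trans (measure_mono_ae ?_) (M.runMeasure_noProgress_le M.isLocal_goodProgress
    (r := M.rGood) (R := M.Rm v) (P := M.Pm v) ((le_max_left _ _).trans (le_max_left _ _))
    ((min_le_left _ _).trans (min_le_left _ _)) s)
  filter_upwards [M.ae_isPath s, M.ae_zero_eq s] with ρ hρ h0 hR
  refine ⟨by rw [Set.mem_ofPred_eq, h0]; exact hs, ?_⟩
  rintro ⟨a, m, ham, hp⟩
  exact hR (M.reach_goodBottom hp.end_mem (M.reach_of_edges hρ ham))

lemma runMeasure_notMem_badBottom_le {s : S} (hs : s ∈ M.canReach M.badBottom \ M.badBottom) :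
    M.runMeasure s {ρ | ρ (M.Rm v) ∉ M.badBottom} ≤ 1 - M.Pm v := by
  refine le_trans (measure_mono_ae ?_) (M.runMeasure_noProgress_le (M.isLocal_badProgress v)
    (r := M.rBad v) (R := M.Rm v) (P := M.Pm v) ((le_max_left _ _).trans (le_max_right _ _))
    ((min_le_right _ _).trans (min_le_left _ _)) s)
  filter_upwards [M.ae_isPath s, M.ae_zero_eq s] with ρ hρ h0 hR
  refine ⟨by rw [Set.mem_ofPred_eq, h0]; exact hs, ?_⟩
  rintro ⟨a, m, ham, hp⟩
  exact hR (M.reach_badBottom hp.end_mem (M.reach_of_edges hρ ham))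

lemma runMeasure_transient_step_le (s : S) :
    M.runMeasure s {ρ | ρ (M.Rm v) ∈ (M.goodBottom ∪ M.badBottom)ᶜ} ≤ 1 - M.Pm v := by
  by_cases hs : s ∈ M.goodBottom ∪ M.badBottom
  · have : M.runMeasure s {ρ | ρ (M.Rm v) ∈ (M.goodBottom ∪ M.badBottom)ᶜ} = 0 := by
      refine measure_eq_zero_iff_ae_notMem.2 ?_
      filter_upwards [M.ae_isPath s, M.ae_zero_eq s] with ρ hρ h0 hR
      have hr := M.reach_of_edges hρ (Nat.zero_le (M.Rm v))
      rw [h0] at hr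
      exact hR (hs.imp (fun h => M.reach_goodBottom h hr) fun h => M.reach_badBottom h hr)
    rw [this]
    exact zero_le
  · rw [Set.mem_union, not_or] at hs
    rcases M.canReach_good_or_bad s with h | h
    · refine (measure_mono fun ρ hρ => ?_).trans (M.runMeasure_notMem_goodBottom_le v ⟨h, hs.1⟩)
      exact fun h' => hρ (Or.inl h')
    · refine (measure_mono fun ρ hρ => ?_).trans (M.runMeasure_notMem_badBottom_le v ⟨h, hs.2⟩)
      exact fun h' => hρ (Or.inr h')

lemma runMeasure_transient_le {v : ℕ} (hv : v ≤ 1) (j : ℕ) (s : S) :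
    M.runMeasure s {ρ | ρ (j * M.window v) ∈ (M.goodBottom ∪ M.badBottom)ᶜ} ≤ 2⁻¹ ^ j := by
  refine le_trans (measure_mono_ae ?_) ((M.runMeasure_iterate_le (decidedBy_at _ _)
    (M.runMeasure_transient_step_le v)
    (j * ⌈(M.Pm v).toReal⁻¹⌉₊) s).trans (M.one_sub_Pm_pow_mul_le hv j))
  filter_upwards [M.ae_isPath s] with ρ hρ hj i hi hmem
  refine hj ?_
  have hle : i * M.Rm v + M.Rm v ≤ j * M.window v := by
    calc i * M.Rm v + M.Rm v = (i + 1) * M.Rm v := by ring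
      _ ≤ (j * ⌈(M.Pm v).toReal⁻¹⌉₊) * M.Rm v := Nat.mul_le_mul_right _ hi
      _ = j * M.window v := by rw [window]; ring
  have hr := M.reach_of_edges hρ hle
  exact hmem.imp (fun h => M.reach_goodBottom h hr) fun h => M.reach_badBottom h hr

/-- The runs that reach a good bottom component. -/
def reachesGood : Set (ℕ → S) := {ρ | ∃ n, ρ n ∈ M.goodBottom}

lemma measurableSet_reachesGood : MeasurableSet M.reachesGood := by
  rw [reachesGood, Set.ofPred_exists]
  exact .iUnion fun n => (decidedBy_at _ n).measurableSet

/-- Let a be the probability of being in a good component at the end of the block and b that of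
reaching one only later. The claim b ≤ (1-P)(a+b) amounts to P(a+b) ≤ a, which follows from P ≤ a
and a + b ≤ 1. The cases in which `s` is already good or can never become so are null. -/
lemma runMeasure_late_step_le (s : S) :
    M.runMeasure s ({ρ | ρ (M.Rm v) ∈ M.goodBottomᶜ} ∩ M.reachesGood) ≤
      (1 - M.Pm v) * M.runMeasure s M.reachesGood := by
  by_cases hs : s ∈ M.canReach M.goodBottom
  · by_cases hs' : s ∈ M.goodBottom
    · have : M.runMeasure s ({ρ | ρ (M.Rm v) ∈ M.goodBottomᶜ} ∩ M.reachesGood) = 0 := by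
        refine measure_eq_zero_iff_ae_notMem.2 ?_
        filter_upwards [M.ae_isPath s, M.ae_zero_eq s] with ρ hρ h0 hR
        have hr := M.reach_of_edges hρ (Nat.zero_le (M.Rm v))
        rw [h0] at hr
        exact hR.1 (M.reach_goodBottom hs' hr)
      rw [this]
      exact zero_le
    · have h1 := M.runMeasure_notMem_goodBottom_le v ⟨hs, hs'⟩
      set a := M.runMeasure s {ρ | ρ (M.Rm v) ∈ M.goodBottom}
      have hm : MeasurableSet {ρ : ℕ → S | ρ (M.Rm v) ∈ M.goodBottom} :=
        (decidedBy_at _ _).measurableSet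
      set b := M.runMeasure s ({ρ | ρ (M.Rm v) ∈ M.goodBottomᶜ} ∩ M.reachesGood)
      have hsum : M.runMeasure s M.reachesGood = a + b := by
        rw [← measure_inter_add_sdiff M.reachesGood hm]
        congr 2
        · refine Set.inter_eq_right.2 fun ρ hρ => ⟨_, hρ⟩
        · ext ρ
          exact and_comm
      have hc : M.runMeasure s {ρ | ρ (M.Rm v) ∉ M.goodBottom} = 1 - a :=
        prob_compl_eq_one_sub hm
      rw [hc] at h1
      have hab : a + b ≤ 1 := hsum ▸ MeasureTheory.prob_le_one
      have hP := M.Pm_le_one v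
      have hPt : M.Pm v ≠ ∞ := ne_top_of_le_ne_top ENNReal.one_ne_top hP
      have ha : a ≤ 1 := MeasureTheory.prob_le_one
      have hat : a ≠ ∞ := ne_top_of_le_ne_top ENNReal.one_ne_top ha
      have hbt : b ≠ ∞ := ne_top_of_le_ne_top ENNReal.one_ne_top (le_add_self.trans hab)
      rw [hsum]
      have h1' := ENNReal.toReal_mono (by finiteness) h1
      have hab' := ENNReal.toReal_mono (by finiteness) hab
      rw [ENNReal.toReal_sub_of_le ha (by finiteness),
        ENNReal.toReal_sub_of_le hP (by finiteness)] at h1'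
      rw [ENNReal.toReal_add hat hbt] at hab'
      rw [← ENNReal.toReal_le_toReal hbt (by finiteness), ENNReal.toReal_mul,
        ENNReal.toReal_add hat hbt, ENNReal.toReal_sub_of_le hP (by finiteness)]
      simp only [ENNReal.toReal_one] at *
      have hP0 : 0 ≤ (M.Pm v).toReal := ENNReal.toReal_nonneg
      nlinarith
  · have : M.runMeasure s ({ρ | ρ (M.Rm v) ∈ M.goodBottomᶜ} ∩ M.reachesGood) = 0 := by
      refine measure_eq_zero_iff_ae_notMem.2 ?_
      filter_upwards [M.ae_isPath s, M.ae_zero_eq s] with ρ hρ h0 hR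
      obtain ⟨n, hn⟩ := hR.2
      have hr := M.reach_of_edges hρ (Nat.zero_le n)
      rw [h0] at hr
      exact hs ⟨_, hn, hr⟩
    rw [this]
    exact zero_le

/-- The good bottom components are reached late with small probability, even when conditioned on
their being reached. -/
lemma runMeasure_late_le (j : ℕ) (s : S) :
    M.runMeasure s ({ρ | ρ (j * M.Rm v) ∈ M.goodBottomᶜ} ∩ M.reachesGood) ≤
      (1 - M.Pm v) ^ j * M.runMeasure s M.reachesGood := by
  induction j generalizing s with
  | zero => simpa using measure_mono Set.inter_subset_right
  | succ j ih =>
    set A : Set (ℕ → S) := {ρ | ρ (M.Rm v) ∈ M.goodBottomᶜ} with hA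
    have hAd : DecidedBy (M.Rm v) A := decidedBy_at _ _
    have hE : MeasurableSet ({ρ | ρ (j * M.Rm v) ∈ M.goodBottomᶜ} ∩ M.reachesGood) :=
      (decidedBy_at _ _).measurableSet.inter M.measurableSet_reachesGood
    calc M.runMeasure s ({ρ | ρ ((j + 1) * M.Rm v) ∈ M.goodBottomᶜ} ∩ M.reachesGood)
        ≤ M.runMeasure s (A ∩ shift (M.Rm v) ⁻¹'
            ({ρ | ρ (j * M.Rm v) ∈ M.goodBottomᶜ} ∩ M.reachesGood)) := by
          refine measure_mono_ae ?_
          filter_upwards [M.ae_isPath s] with ρ hρ hmem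
          obtain ⟨h1, n, hn⟩ := hmem
          have h1' : ρ ((j + 1) * M.Rm v) ∉ M.goodBottom := h1
          have hlt : (j + 1) * M.Rm v < n := by
            by_contra hcon
            exact h1' (M.reach_goodBottom hn (M.reach_of_edges hρ (not_lt.1 hcon)))
          have hle : M.Rm v ≤ (j + 1) * M.Rm v := Nat.le_mul_of_pos_left _ (Nat.succ_pos j)
          refine ⟨fun h => h1' (M.reach_goodBottom h (M.reach_of_edges hρ hle)), fun h => h1' ?_,
            n - M.Rm v, ?_⟩
          · rw [shift_apply] at h
            rwa [add_mul, one_mul, add_comm]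
          · rw [shift_apply]
            rwa [Nat.add_sub_cancel' (by omega)]
      _ = ∫⁻ ρ in A, M.runMeasure (ρ (M.Rm v))
            ({ρ | ρ (j * M.Rm v) ∈ M.goodBottomᶜ} ∩ M.reachesGood) ∂M.runMeasure s :=
          M.runMeasure_inter_shift s _ hAd hE
      -- The factor that depends on the state reached is kept, so that the Markov property can be
      -- undone in the next line; this preserves the factor for reaching a good component.
      _ ≤ ∫⁻ ρ in A, (1 - M.Pm v) ^ j * M.runMeasure (ρ (M.Rm v)) M.reachesGood
            ∂M.runMeasure s := lintegral_mono fun ρ => ih _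
      _ = (1 - M.Pm v) ^ j * M.runMeasure s (A ∩ shift (M.Rm v) ⁻¹' M.reachesGood) := by
          rw [M.runMeasure_inter_shift s _ hAd M.measurableSet_reachesGood, lintegral_const_mul]
          exact (Measurable.of_discrete (f := fun t => M.runMeasure t M.reachesGood)).comp
            (measurable_pi_apply _)
      _ ≤ (1 - M.Pm v) ^ j * M.runMeasure s (A ∩ M.reachesGood) := by
          gcongr
          rintro ρ ⟨n, hn⟩
          exact ⟨_, hn⟩
      _ ≤ (1 - M.Pm v) ^ j * ((1 - M.Pm v) * M.runMeasure s M.reachesGood) := by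
          gcongr
          exact M.runMeasure_late_step_le v s
      _ = (1 - M.Pm v) ^ (j + 1) * M.runMeasure s M.reachesGood := by ring

lemma runMeasure_late_window_le {v : ℕ} (hv : v ≤ 1) (j : ℕ) (s : S) :
    M.runMeasure s ({ρ | ρ (j * M.window v) ∈ M.goodBottomᶜ} ∩ M.reachesGood) ≤
      2⁻¹ ^ j * M.runMeasure s M.reachesGood := by
  have h := M.runMeasure_late_le v (j * ⌈(M.Pm v).toReal⁻¹⌉₊) s
  have : j * ⌈(M.Pm v).toReal⁻¹⌉₊ * M.Rm v = j * M.window v := by rw [window]; ring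
  rw [this] at h
  exact h.trans (mul_le_mul_left (M.one_sub_Pm_pow_mul_le hv j) _)

/-- Good runs almost surely reach a good bottom component. -/
lemma Pgood_le {v : ℕ} (hv : v ≤ 1) : M.Pgood ≤ M.runMeasure M.init M.reachesGood := by
  refine measure_mono_ae ?_
  have h1 : ∀ᵐ ρ ∂M.runMeasure M.init, ∃ n, ρ n ∈ M.goodBottom ∪ M.badBottom := by
    refine ae_iff.2 (eq_zero_of_forall_le_half_pow fun j => ?_)
    refine (measure_mono fun ρ hρ => ?_).trans (M.runMeasure_transient_le hv j M.init)
    exact fun h => hρ ⟨_, h⟩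
  -- Almost surely, after every time spent in a bad component, bad progress occurs again.
  have h2 : ∀ᵐ ρ ∂M.runMeasure M.init, ∀ D, ¬ (ρ D ∈ M.badBottom ∧
      ∀ j, shift D ρ ∈ noProgress (M.BadProgress v) (j * M.window v)) := by
    refine ae_all_iff.2 fun D => ae_iff.2 (eq_zero_of_forall_le_half_pow fun j => ?_)
    have hm : MeasurableSet ({ρ : ℕ → S | ρ 0 ∈ M.badBottom} ∩
        noProgress (M.BadProgress v) (j * M.window v)) :=
      (decidedBy_at _ _).measurableSet.inter
        ((M.isLocal_badProgress v).decidedBy_noProgress _).measurableSet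
    refine (measure_mono fun ρ hρ => ?_).trans
      (M.runMeasure_shift_le M.init D hm (M.runMeasure_noBadProgress_le hv j))
    simp only [not_not, Set.mem_ofPred_eq] at hρ
    exact ⟨hρ.1, hρ.2 j⟩
  filter_upwards [h1, h2, M.ae_isPath M.init] with ρ h1 h2 hρ hgood
  obtain ⟨n, hn | hn⟩ := h1
  · exact ⟨n, hn⟩
  exfalso
  obtain ⟨l, hinf, hfin⟩ := hgood
  obtain ⟨D0, hD0⟩ := hfin.bddAbove
  -- Beyond the last `f_l` and inside the bad component. As `e_l` still occurs later, `e_l` lies in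
  -- the component, so bad progress after `D` would produce another `f_l`.
  set D := max n (D0 + 1) with hD
  have hDb : ρ D ∈ M.badBottom := M.reach_badBottom hn (M.reach_of_edges hρ (le_max_left _ _))
  refine h2 D ⟨hDb, fun j => ?_⟩
  rintro ⟨a, m, -, hp⟩
  rw [shift_shift] at hp
  have hst : ρ (D + a) ∈ M.badBottom :=
    M.reach_badBottom hDb (M.reach_of_edges hρ (Nat.le_add_right _ _))
  obtain ⟨-, -, h | ⟨B, hB, h0, -, hB'⟩⟩ := hp
  · exact h.1.2 hst
  · obtain ⟨u, hu, hDu⟩ := hinf.exists_gt (D + a)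
    obtain ⟨i, -, -, hi⟩ := hB' l ⟨ρ u, hB.reach_mem h0 (M.reach_of_edges hρ hDu.le), hu⟩
    have := hD0 (show D + a + i ∈ _ from hi)
    omega

end Windows

/-! ### What the outcome of a check says about progress -/

section GoodWindow

variable {k : ℕ} {S : Type*} (M : POMC S (Set (Marker k)))

/-- The part of the run between the times `n` and `2 n` is good. -/
def GoodWindow (ρ : ℕ → S) (n : ℕ) : Prop :=
  ∃ l, n = 0 ∨ ((∃ u, n ≤ u ∧ u ≤ 2 * n ∧ Marker.e l ∈ M.obs (ρ u)) ∧
    ∀ u, n ≤ u → u ≤ 2 * n → Marker.f l ∉ M.obs (ρ u))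

lemma goodPath_secondHalf_iff (ρ : ℕ → S) (n : ℕ) :
    GoodPath (secondHalf ((List.range (2 * n + 1)).map fun i => M.obs (ρ i))) ↔
      M.GoodWindow ρ n := by
  have hmem : ∀ α, α ∈ secondHalf ((List.range (2 * n + 1)).map fun i => M.obs (ρ i)) ↔
      ∃ u, n ≤ u ∧ u ≤ 2 * n ∧ M.obs (ρ u) = α := by
    intro α
    rw [secondHalf, List.length_map, List.length_range, show (2 * n + 1) / 2 = n by omega,
      ← List.map_drop, List.mem_map]
    constructor
    · rintro ⟨u, hu, rfl⟩
      obtain ⟨i, hi, rfl⟩ := List.mem_iff_getElem.1 hu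
      simp only [List.length_drop, List.length_range] at hi
      exact ⟨_, by simp, by simp; omega, rfl⟩
    · rintro ⟨u, h1, h2, rfl⟩
      refine ⟨u, List.mem_iff_getElem.2 ⟨u - n, ?_, ?_⟩, rfl⟩
      · simp only [List.length_drop, List.length_range]; omega
      · simp only [List.getElem_drop, List.getElem_range]; omega
  have hlen : (secondHalf ((List.range (2 * n + 1)).map fun i => M.obs (ρ i))).length ≤ 1 ↔
      n = 0 := by
    simp only [secondHalf, List.length_drop, List.length_map, List.length_range]
    omega
  simp only [GoodPath, GoodWindow, hlen, hmem]
  refine exists_congr fun l => or_congr_right (and_congr ?_ ?_)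
  · constructor
    · rintro ⟨α, ⟨u, h1, h2, rfl⟩, h⟩
      exact ⟨u, h1, h2, h⟩
    · rintro ⟨u, h1, h2, h⟩
      exact ⟨_, ⟨u, h1, h2, rfl⟩, h⟩
  · constructor
    · exact fun h u h1 h2 => h _ ⟨u, h1, h2, rfl⟩
    · rintro h α ⟨u, h1, h2, rfl⟩
      exact h u h1 h2

lemma badAt_iff (F : ℕ) (ρ : ℕ → S) (t : ℕ) :
    M.BadAt F ρ t ↔ ∃ i, t = 2 * (F * i) ∧ ¬ M.GoodWindow ρ (F * i) := by
  constructor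
  · rintro ⟨⟨i, rfl⟩, h⟩
    rw [mul_assoc, goodPath_secondHalf_iff] at h
    exact ⟨i, by ring, h⟩
  · rintro ⟨i, rfl, h⟩
    refine ⟨⟨i, by ring⟩, ?_⟩
    rwa [goodPath_secondHalf_iff]

variable {M}

/-- In an `i`-good component `f_i` never occurs, so a good progress path inside the window would
supply the `e_i` that makes the window good. -/
lemma noProgress_of_not_goodWindow {ρ : ℕ → S} (hρ : ∀ n, M.Edge (ρ n) (ρ (n + 1))) {D n a L : ℕ}
    (hD : ρ D ∈ M.goodBottom) (hDn : D ≤ n) (h : ¬ M.GoodWindow ρ n) (hna : n ≤ a)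
    (haL : a + L ≤ 2 * n) : shift a ρ ∈ noProgress M.GoodProgress L := by
  rintro ⟨b, m, hbm, -, -, hp⟩
  rw [shift_shift] at hp
  obtain ⟨B', hB', hD', hg⟩ := hD
  rcases hp with hp | ⟨B, i, hB, h0, hi, he⟩
  · exact hp.1.2 (M.reach_goodBottom ⟨B', hB', hD', hg⟩ (M.reach_of_edges hρ (by omega)))
  · have h0' : shift (a + b) ρ 0 ∈ B' := hB'.reach_mem hD' (M.reach_of_edges hρ (by omega))
    obtain rfl := hB.eq_of_mem hB' h0 h0'
    refine h ⟨i, Or.inr ⟨⟨a + b + m, by omega, by omega, he⟩, fun u hu _ => ?_⟩⟩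
    exact hi.2 _ (hB.reach_mem hD' (M.reach_of_edges hρ (by omega)))

/-- A window that is good for `l` shows that `e_l` occurs in the component, so bad progress would
have to visit `f_l`, which the window avoids. -/
lemma noProgress_of_goodWindow {v : ℕ} {ρ : ℕ → S} (hρ : ∀ n, M.Edge (ρ n) (ρ (n + 1))) {D n : ℕ}
    (hD : ρ D ∈ M.badBottom) (hDn : D ≤ n) (hn : 0 < n) (h : M.GoodWindow ρ n) :
    shift n ρ ∈ noProgress (M.BadProgress v) n := by
  rintro ⟨b, m, hbm, -, -, hp⟩
  rw [shift_shift] at hp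
  obtain ⟨B', hB', hD', hbad⟩ := hD
  rcases hp with hp | ⟨B, hB, h0, -, hf⟩
  · exact hp.1.2 (M.reach_badBottom ⟨B', hB', hD', hbad⟩ (M.reach_of_edges hρ (by omega)))
  · have h0' : shift (n + b) ρ 0 ∈ B' := hB'.reach_mem hD' (M.reach_of_edges hρ (by omega))
    obtain rfl := hB.eq_of_mem hB' h0 h0'
    obtain ⟨l, hl⟩ := h
    rcases hl with rfl | ⟨⟨u, hu, -, he⟩, hl⟩
    · exact absurd hn (lt_irrefl 0)
    · obtain ⟨j, -, hj, hf⟩ := hf l ⟨ρ u, hB.reach_mem hD' (M.reach_of_edges hρ (by omega)), he⟩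
      exact hl (n + b + j) (by omega) (by omega) hf

end GoodWindow

/-! ### Cost and restart probability of one phase -/

section Tail

variable {k : ℕ} {S : Type*} [Finite S] [MeasurableSpace S] [DiscreteMeasurableSpace S]
  (M : POMC S (Set (Marker k))) {v : ℕ}

lemma tsum_half_pow_le {j : ℕ} (hj : 1 ≤ j) :
    ∑' m : ℕ, (2⁻¹ : ℝ≥0∞) ^ (j * (m + 1)) ≤ 2 * 2⁻¹ ^ j := by
  calc ∑' m : ℕ, (2⁻¹ : ℝ≥0∞) ^ (j * (m + 1)) ≤ ∑' m : ℕ, 2⁻¹ ^ j * 2⁻¹ ^ m := by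
        refine ENNReal.tsum_le_tsum fun m => ?_
        rw [← pow_add]
        refine pow_le_pow_right_of_le_one' (ENNReal.inv_le_one.2 (by norm_num)) ?_
        nlinarith
    _ = 2 * 2⁻¹ ^ j := by
        rw [ENNReal.tsum_mul_left, ENNReal.tsum_geometric, ENNReal.one_sub_inv_two, inv_inv,
          mul_comm]

/-- The probability that the first bad time is finite, but late. -/
lemma runMeasure_firstBadFrom_le (hv : v ≤ 1) {F j : ℕ} (hF : 1 ≤ F) (hj : 1 ≤ j)
    (hFj : F ≤ j * M.window v) (s : S) :
    M.runMeasure s {ρ | FirstBadFrom (M.BadAt F ρ) (4 * (j * M.window v) + 1)} ≤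
      4 * 2⁻¹ ^ j := by
  set D := j * M.window v with hD
  -- A multiple of `F` between `D` and `2 * D`, available since `F ≤ D`. The check at time `2 * n₀`
  -- comes before `4 * D + 1`, so it must have passed, and its window contains `D` steps after time
  -- `D`.
  set n₀ := F * (2 * D / F) with hn₀
  have hn1 : D ≤ n₀ := by
    have h1 := Nat.div_add_mod (2 * D) F
    have h2 := Nat.mod_lt (2 * D) hF
    omega
  have hn2 : n₀ ≤ 2 * D := Nat.mul_div_le _ _
  set E1 : Set (ℕ → S) := {ρ | ρ D ∈ (M.goodBottom ∪ M.badBottom)ᶜ} with hE1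
  set E2 : Set (ℕ → S) := {ρ | ρ 0 ∈ M.badBottom} ∩ noProgress (M.BadProgress v) D with hE2
  -- Failed checks are grouped by a grid of mesh `D`: if n/D has integer part m + 2, the window from
  -- n to 2n contains the interval of length (m+1)D that starts at (m+3)D. The union over `m` then
  -- gives a geometric series.
  set E3 : ℕ → Set (ℕ → S) := fun m =>
    {ρ | ρ 0 ∈ M.goodBottom} ∩ noProgress M.GoodProgress ((j * (m + 1)) * M.window v) with hE3
  have hm2 : MeasurableSet E2 := (decidedBy_at _ _).measurableSet.inter
    ((M.isLocal_badProgress v).decidedBy_noProgress _).measurableSet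
  have hm3 : ∀ m, MeasurableSet (E3 m) := fun m => (decidedBy_at _ _).measurableSet.inter
    (M.isLocal_goodProgress.decidedBy_noProgress _).measurableSet
  calc M.runMeasure s {ρ | FirstBadFrom (M.BadAt F ρ) (4 * D + 1)}
      ≤ M.runMeasure s (E1 ∪ shift n₀ ⁻¹' E2 ∪ ⋃ m, shift ((m + 3) * D) ⁻¹' E3 m) := by
        refine measure_mono_ae ?_
        filter_upwards [M.ae_isPath s] with ρ hρ hmem
        obtain ⟨hlate, t, ht⟩ := hmem
        by_cases hg : ρ D ∈ M.goodBottom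
        · refine Or.inr (Set.mem_iUnion.2 ?_)
          have ht' : 4 * D + 1 ≤ t := by
            by_contra hcon
            exact hlate t (by omega) ht
          obtain ⟨i, rfl, hi⟩ := (M.badAt_iff F ρ t).1 ht
          set n := F * i
          have hd1 := Nat.div_add_mod n D
          have hd2 := Nat.mod_lt n (show 0 < D by omega)
          have hd3 : 2 ≤ n / D := by
            rw [Nat.le_div_iff_mul_le (by omega)]
            omega
          obtain ⟨m, hm⟩ : ∃ m, n / D = m + 2 := ⟨n / D - 2, by omega⟩
          rw [hm] at hd1
          have hd4 : D * (m + 2) + D = (m + 3) * D := by ring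
          have hd5 : (m + 3) * D + (m + 1) * D = 2 * (D * (m + 2)) := by ring
          have hd6 : j * (m + 1) * M.window v = (m + 1) * D := by rw [hD]; ring
          refine ⟨m, M.reach_goodBottom hg (M.reach_of_edges hρ ?_), ?_⟩
          · rw [add_zero, ← hd4]; omega
          · refine noProgress_of_not_goodWindow hρ hg (n := n) (by omega) hi (by omega) ?_
            rw [hd6]
            omega
        · left
          by_cases hb : ρ D ∈ M.badBottom
          · right
            have hnb : ¬ M.BadAt F ρ (2 * n₀) := hlate _ (by omega)
            have hw : M.GoodWindow ρ n₀ := by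
              by_contra hcon
              exact hnb ((M.badAt_iff F ρ _).2 ⟨2 * D / F, rfl, hcon⟩)
            refine ⟨M.reach_badBottom hb (M.reach_of_edges hρ (by simpa using hn1)), ?_⟩
            exact noProgress_anti hn1 (noProgress_of_goodWindow hρ hb hn1 (by omega) hw)
          · left
            exact fun h => h.elim hg hb
    _ ≤ M.runMeasure s E1 + M.runMeasure s (shift n₀ ⁻¹' E2) +
          ∑' m, M.runMeasure s (shift ((m + 3) * D) ⁻¹' E3 m) :=
        (measure_union_le _ _).trans (add_le_add (measure_union_le _ _) (measure_iUnion_le _))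
    _ ≤ 2⁻¹ ^ j + 2⁻¹ ^ j + ∑' m : ℕ, 2⁻¹ ^ (j * (m + 1)) := by
        refine add_le_add (add_le_add ?_ ?_) (ENNReal.tsum_le_tsum fun m => ?_)
        · exact M.runMeasure_transient_le hv j s
        · exact M.runMeasure_shift_le s _ hm2 (M.runMeasure_noBadProgress_le hv j)
        · exact M.runMeasure_shift_le s _ (hm3 m) (M.runMeasure_noGoodProgress_le hv _)
    _ ≤ 2⁻¹ ^ j + 2⁻¹ ^ j + 2 * 2⁻¹ ^ j := by
        gcongr
        exact tsum_half_pow_le hj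
    _ = 4 * 2⁻¹ ^ j := by ring

lemma FirstBadFrom.anti {bad : ℕ → Prop} {i j : ℕ} (h : FirstBadFrom bad j) (hij : i ≤ j) :
    FirstBadFrom bad i :=
  ⟨fun l hl => h.1 l (hl.trans_le hij), h.2⟩

lemma window_pos (hv : v ≤ 1) : 0 < M.window v := by
  refine Nat.mul_pos (M.Rm_pos hv) (Nat.ceil_pos.2 (inv_pos.2 ?_))
  exact ENNReal.toReal_pos (M.Pm_pos hv).ne'
    (ne_top_of_le_ne_top ENNReal.one_ne_top (M.Pm_le_one v))

/-- The cost is a sum of tail probabilities. The first `N₀`, at most 4F + 5W in number, are bounded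
by 1; afterwards the bound 4·2^(-j) halves every 4W steps, and these terms add up to at most 16W. -/
lemma phaseCost_le (hv : v ≤ 1) {F : ℕ} (hF : 1 ≤ F) :
    M.phaseCost F ≤ ((4 * F + 21 * M.window v : ℕ) : ℝ≥0∞) := by
  set W := M.window v with hW
  have hW0 : 0 < W := M.window_pos hv
  have hmeas : ∀ t, MeasurableSet {ρ : ℕ → S | M.BadAt F ρ t} := fun t =>
    (M.decidedBy_badAt F t).measurableSet
  -- Rounded up so that `F ≤ j * W` for every `j ≥ j₀`, as the tail bound requires.
  set j₀ := F / W + 1 with hj₀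
  set N₀ := 4 * (j₀ * W) + 1 with hN₀
  set g : ℕ → ℝ≥0∞ := fun j => M.runMeasure M.init {ρ | FirstBadFrom (M.BadAt F ρ) j} with hg
  have hcost : M.phaseCost F = ∑' j, g j := by
    rw [phaseCost]
    simp only [stepsAfterFirstBad]
    rw [lintegral_tsum fun j => (Measurable.ite (measurableSet_firstBadFrom hmeas j)
      measurable_const measurable_const).aemeasurable]
    refine tsum_congr fun j => ?_
    exact lintegral_indicator_one (measurableSet_firstBadFrom hmeas j)
  have hanti : Antitone g := fun i j hij => measure_mono fun ρ hρ => FirstBadFrom.anti hρ hij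
  have htail : ∑' j, g (j + N₀) ≤ 16 * W := by
    have : NeZero (4 * W) := ⟨by omega⟩
    calc ∑' j, g (j + N₀) ≤ ∑' j : ℕ, 4 * 2⁻¹ ^ (j / (4 * W) + 1) := by
          refine ENNReal.tsum_le_tsum fun j => ?_
          have h1 := Nat.div_add_mod j (4 * W)
          have h2 : N₀ + 4 * W * (j / (4 * W)) = 4 * ((j / (4 * W) + j₀) * W) + 1 := by
            rw [hN₀]; ring
          have h3 : F ≤ (j / (4 * W) + j₀) * W := by
            have h4 := Nat.lt_div_mul_add (a := F) hW0
            have h5 : (j / (4 * W) + j₀) * W = j / (4 * W) * W + (F / W * W + W) := by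
              rw [hj₀]; ring
            rw [h5]
            omega
          refine (hanti (show 4 * ((j / (4 * W) + j₀) * W) + 1 ≤ j + N₀ by omega)).trans ?_
          refine (M.runMeasure_firstBadFrom_le hv hF
            ((Nat.le_add_left 1 _).trans (Nat.le_add_left _ _)) h3 M.init).trans ?_
          gcongr 4 * ?_
          exact pow_le_pow_right_of_le_one' (ENNReal.inv_le_one.2 (by norm_num))
            (Nat.add_le_add_left (Nat.le_add_left 1 _) _)
      -- Division with remainder by `4 * W` groups the equal terms.
      _ = ∑' p : ℕ × Fin (4 * W), 4 * 2⁻¹ ^ (p.1 + 1) := by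
          rw [← (Nat.divModEquiv (4 * W)).tsum_eq]
          rfl
      _ = 16 * W := by
          rw [ENNReal.tsum_prod (f := fun (a : ℕ) (_ : Fin (4 * W)) => (4 : ℝ≥0∞) * 2⁻¹ ^ (a + 1))]
          simp only [tsum_fintype, Finset.sum_const, Finset.card_univ, Fintype.card_fin,
            nsmul_eq_mul, ENNReal.tsum_mul_left, ENNReal.tsum_geometric_add_one,
            ENNReal.one_sub_inv_two, inv_inv]
          rw [ENNReal.inv_mul_cancel (by norm_num) (by norm_num)]
          push_cast
          ring
  have hhead : ∑ j ∈ Finset.range N₀, g j ≤ N₀ := by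
    refine (Finset.sum_le_card_nsmul _ _ 1 fun j _ => MeasureTheory.prob_le_one).trans ?_
    simp
  have hN : N₀ ≤ 4 * F + 5 * W := by
    have h4 := Nat.div_mul_le_self F W
    have h5 : j₀ * W = F / W * W + W := by rw [hj₀]; ring
    omega
  rw [hcost, ← ENNReal.summable.sum_add_tsum_nat_add' (k := N₀)]
  calc ∑ j ∈ Finset.range N₀, g j + ∑' j, g (j + N₀) ≤ N₀ + 16 * W := add_le_add hhead htail
    _ ≤ ((4 * F + 5 * W : ℕ) : ℝ≥0∞) + 16 * W := by gcongr
    _ = ((4 * F + 21 * W : ℕ) : ℝ≥0∞) := by push_cast; ring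

lemma restartProb_eq (F : ℕ) :
    M.restartProb F = M.runMeasure M.init {ρ | ∃ t, M.BadAt F ρ t} := by
  rw [restartProb, ← lintegral_indicator_one
    (measurableSet_exists_bad fun t => (M.decidedBy_badAt F t).measurableSet)]
  rfl

lemma restartProb_le_one (F : ℕ) : M.restartProb F ≤ 1 :=
  (M.restartProb_eq F).le.trans MeasureTheory.prob_le_one

/-- With ε = 2^(-j), a good component is reached by time `F` with probability at least P_good(1-ε),
and from then on all checks pass with conditional probability at least 1-2ε; finally (1-ε)(1-2ε) ≥
1-3ε. -/
lemma restartProb_toReal_le (hv : v ≤ 1) {F j : ℕ} (hj : 1 ≤ j)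
    (hF : j * M.window v ≤ F) :
    (M.restartProb F).toReal ≤ 1 - M.Pgood.toReal * (1 - 3 * 2⁻¹ ^ j) := by
  set μ := M.runMeasure M.init with hμ
  set A : Set (ℕ → S) := {ρ | ρ F ∈ M.goodBottom} with hA
  have hAd : DecidedBy F A := decidedBy_at _ _
  -- Seen from time `F`: the check number `m + 1` has a window that starts `m * F` later and has
  -- length F(m+1) ≥ j(m+1)W. Longer windows make the failures summable.
  set E : Set (ℕ → S) := ⋃ m : ℕ, shift (m * F) ⁻¹'
    ({ρ | ρ 0 ∈ M.goodBottom} ∩ noProgress M.GoodProgress ((j * (m + 1)) * M.window v)) with hE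
  have hm : ∀ m : ℕ, MeasurableSet ({ρ : ℕ → S | ρ 0 ∈ M.goodBottom} ∩
      noProgress M.GoodProgress ((j * (m + 1)) * M.window v)) := fun m =>
    (decidedBy_at _ _).measurableSet.inter
      (M.isLocal_goodProgress.decidedBy_noProgress _).measurableSet
  have hEm : MeasurableSet E := .iUnion fun m => measurable_shift _ (hm m)
  have hEle : ∀ t, M.runMeasure t E ≤ 2 * 2⁻¹ ^ j := by
    intro t
    refine (measure_iUnion_le _).trans (le_trans (ENNReal.tsum_le_tsum fun m => ?_)
      (tsum_half_pow_le hj))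
    exact M.runMeasure_shift_le t _ (hm m) (M.runMeasure_noGoodProgress_le hv _)
  have h1 : M.restartProb F ≤ μ Aᶜ + 2 * 2⁻¹ ^ j * μ A := by
    rw [restartProb_eq]
    refine le_trans (measure_mono_ae ?_) ((measure_union_le Aᶜ (A ∩ shift F ⁻¹' E)).trans
      (by gcongr; exact M.runMeasure_inter_shift_le _ F hAd hEm hEle))
    filter_upwards [M.ae_isPath M.init] with ρ hρ hbad
    by_cases hρA : ρ ∈ A
    swap
    · exact Or.inl hρA
    refine Or.inr ⟨hρA, ?_⟩
    obtain ⟨t, ht⟩ := hbad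
    obtain ⟨i, -, hi⟩ := (M.badAt_iff F ρ t).1 ht
    have hg : ρ F ∈ M.goodBottom := hρA
    cases i with
    | zero =>
      -- The path of length 0 passes the check, but only if there is an index to witness it; the
      -- good component provides one.
      obtain ⟨B, -, -, l, -⟩ := hg
      exact absurd ⟨l, Or.inl (mul_zero F)⟩ hi
    | succ m =>
      refine Set.mem_iUnion.2 ⟨m, ?_, ?_⟩
      · exact M.reach_goodBottom hg (M.reach_of_edges hρ (by omega))
      · rw [shift_shift]
        refine noProgress_of_not_goodWindow hρ hg (Nat.le_mul_of_pos_right F (show 0 < m + 1 by omega)) hi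
          (le_of_eq (by ring)) ?_
        have : j * (m + 1) * M.window v ≤ F * (m + 1) := by
          calc j * (m + 1) * M.window v = (j * M.window v) * (m + 1) := by ring
            _ ≤ F * (m + 1) := Nat.mul_le_mul_right _ hF
        have h2 : F + m * F = F * (m + 1) := by ring
        omega
  have h2 : M.runMeasure M.init M.reachesGood ≤
      μ A + 2⁻¹ ^ j * M.runMeasure M.init M.reachesGood := by
    refine le_trans ?_ (add_le_add le_rfl (M.runMeasure_late_window_le hv j M.init))
    refine le_trans (measure_mono_ae ?_) (measure_union_le _ _)
    filter_upwards [M.ae_isPath M.init] with ρ hρ hr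
    by_cases h : ρ (j * M.window v) ∈ M.goodBottom
    · exact Or.inl (M.reach_goodBottom h (M.reach_of_edges hρ hF))
    · exact Or.inr ⟨h, hr⟩
  have h3 := M.Pgood_le hv
  have hAc : μ Aᶜ = 1 - μ A := prob_compl_eq_one_sub hAd.measurableSet
  have hA1 : μ A ≤ 1 := MeasureTheory.prob_le_one
  have hR1 : M.runMeasure M.init M.reachesGood ≤ 1 := MeasureTheory.prob_le_one
  have hAt : μ A ≠ ∞ := ne_top_of_le_ne_top ENNReal.one_ne_top hA1
  have hRt : M.runMeasure M.init M.reachesGood ≠ ∞ := ne_top_of_le_ne_top ENNReal.one_ne_top hR1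
  have hε : (2⁻¹ : ℝ≥0∞) ^ j ≠ ∞ := by finiteness
  rw [hAc] at h1
  have h1' := ENNReal.toReal_mono (by finiteness) h1
  have h2' := ENNReal.toReal_mono (by finiteness) h2
  have h3' := ENNReal.toReal_mono hRt h3
  rw [ENNReal.toReal_add (by finiteness) (by finiteness), ENNReal.toReal_sub_of_le hA1
    (by finiteness), ENNReal.toReal_mul, ENNReal.toReal_mul, ENNReal.toReal_pow,
    ENNReal.toReal_inv] at h1'
  rw [ENNReal.toReal_add (by finiteness) (by finiteness), ENNReal.toReal_mul, ENNReal.toReal_pow,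
    ENNReal.toReal_inv] at h2'
  simp only [ENNReal.toReal_one, ENNReal.toReal_ofNat] at h1' h2'
  set ε : ℝ := 2⁻¹ ^ j
  set a := (μ A).toReal
  set r := (M.runMeasure M.init M.reachesGood).toReal
  have hε0 : 0 ≤ ε := by positivity
  have hε1 : ε ≤ 1 / 2 := by
    calc ε ≤ 2⁻¹ ^ 1 := pow_le_pow_of_le_one (by norm_num) (by norm_num) hj
      _ = 1 / 2 := by norm_num
  have hp0 : 0 ≤ M.Pgood.toReal := ENNReal.toReal_nonneg
  have ha : M.Pgood.toReal * (1 - ε) ≤ a := by nlinarith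
  nlinarith [mul_le_mul_of_nonneg_right ha (show 0 ≤ 1 - 2 * ε by linarith), mul_nonneg hp0
    (mul_nonneg hε0 hε0)]

end Tail

/-! ### Summing the phases -/

section Recursion

/-- The total cost from phase `n` on, if phase `m` costs `E m` and is followed by another phase with
probability `q m`. -/
noncomputable def totalCost (E q : ℕ → ℝ≥0∞) (n : ℕ) : ℝ≥0∞ :=
  ∑' m, (∏ i ∈ Finset.range m, q (n + i)) * E (n + m)

lemma totalCost_eq (E q : ℕ → ℝ≥0∞) (n : ℕ) :
    E n + q n * totalCost E q (n + 1) = totalCost E q n := by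
  conv_rhs => rw [totalCost, tsum_eq_zero_add' ENNReal.summable]
  rw [totalCost, ← ENNReal.tsum_mul_left]
  simp only [Finset.range_zero, Finset.prod_empty, one_mul, add_zero]
  congr 1
  refine tsum_congr fun m => ?_
  rw [Finset.prod_range_succ', ← mul_assoc, add_zero, mul_comm (q n)]
  simp only [add_assoc, add_comm 1]

lemma summable_choose_mul_pow (c : ℕ) {x : ℝ} (hx0 : 0 ≤ x) (hx1 : x < 1) :
    Summable fun l : ℕ => ((l + c).choose c : ℝ) * x ^ l :=
  summable_choose_mul_geometric_of_norm_lt_one c (by rwa [Real.norm_of_nonneg hx0])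

/-- The first `N` phases cost at most 25A each. Phase N+1+l has weight at most x^l, and its cost is
controlled by (N+l+1)^c ≤ 2^c(N^c + (l+1)^c) with (l+1)^c ≤ c!·C(l+c, c), a form chosen because the
series of C(l+c, c)x^l is exactly (1-x)^(-(c+1)). -/
lemma totalCost_le {E q : ℕ → ℝ≥0∞} {c N : ℕ} {A x : ℝ} (hx0 : 0 ≤ x) (hx1 : x < 1) (hA : 0 ≤ A)
    (hN : (N : ℝ) ^ c ≤ A) (hE : ∀ n, 1 ≤ n → E n ≤ ENNReal.ofReal (4 * (n : ℝ) ^ c + 21 * A))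
    (hq : ∀ n, q n ≤ 1) (hq' : ∀ n, N < n → q n ≤ ENNReal.ofReal x) :
    totalCost E q 1 ≤ ENNReal.ofReal (25 * (N * A) + 25 * 2 ^ c * (A / (1 - x)) +
      25 * 2 ^ c * (c ! / (1 - x) ^ (c + 1))) := by
  have hE1 : ∀ m < N, E (1 + m) ≤ ENNReal.ofReal (25 * A) := by
    intro m hm
    refine (hE _ (by omega)).trans (ENNReal.ofReal_le_ofReal ?_)
    have : ((1 + m : ℕ) : ℝ) ^ c ≤ (N : ℝ) ^ c := by
      gcongr
      omega
    linarith
  have hE2 : ∀ l, E (1 + (l + N)) ≤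
      ENNReal.ofReal (25 * 2 ^ c * A + 25 * 2 ^ c * (c ! * (l + c).choose c)) := by
    intro l
    refine (hE _ (by omega)).trans (ENNReal.ofReal_le_ofReal ?_)
    have h1 : ((1 + (l + N) : ℕ) : ℝ) ^ c ≤ 2 ^ c * (A + c ! * (l + c).choose c) := by
      calc ((1 + (l + N) : ℕ) : ℝ) ^ c = ((N : ℝ) + ((l + 1 : ℕ) : ℝ)) ^ c := by
            push_cast; ring
        _ ≤ 2 ^ (c - 1) * ((N : ℝ) ^ c + ((l + 1 : ℕ) : ℝ) ^ c) :=
            add_pow_le (by positivity) (by positivity) c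
        _ ≤ 2 ^ c * (A + c ! * (l + c).choose c) := by
            gcongr
            · norm_num
            · omega
            · rw [← Nat.cast_mul, ← Nat.ascFactorial_eq_factorial_mul_choose]
              exact_mod_cast Nat.pow_succ_le_ascFactorial (l + 1) c
    have h2 : A ≤ 2 ^ c * A := le_mul_of_one_le_left hA (one_le_pow₀ (by norm_num))
    have h3 : 0 ≤ (2 : ℝ) ^ c * (c ! * (l + c).choose c) := by positivity
    linarith
  have hprod : ∀ l, ∏ i ∈ Finset.range (l + N), q (1 + i) ≤ ENNReal.ofReal (x ^ l) := by
    intro l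
    rw [add_comm, Finset.prod_range_add, ENNReal.ofReal_pow hx0]
    calc (∏ i ∈ Finset.range N, q (1 + i)) * ∏ i ∈ Finset.range l, q (1 + (N + i))
        ≤ 1 * ∏ _i ∈ Finset.range l, ENNReal.ofReal x := by
          gcongr
          · exact Finset.prod_le_one' fun i _ => hq _
          · exact hq' _ (by omega)
      _ = ENNReal.ofReal x ^ l := by simp
  have hy : 0 < 1 - x := by linarith
  have hs1 : Summable fun l : ℕ => 25 * 2 ^ c * A * x ^ l :=
    (summable_geometric_of_lt_one hx0 hx1).mul_left _
  have hs2 : Summable fun l : ℕ => 25 * 2 ^ c * (c ! : ℝ) * (((l + c).choose c : ℝ) * x ^ l) :=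
    (summable_choose_mul_pow c hx0 hx1).mul_left _
  have hsum : ∑' l : ℕ, (25 * 2 ^ c * A * x ^ l +
      25 * 2 ^ c * (c ! : ℝ) * (((l + c).choose c : ℝ) * x ^ l)) =
      25 * 2 ^ c * (A / (1 - x)) + 25 * 2 ^ c * (c ! / (1 - x) ^ (c + 1)) := by
    rw [hs1.tsum_add hs2, tsum_mul_left, tsum_mul_left, tsum_geometric_of_lt_one hx0 hx1,
      tsum_choose_mul_geometric_of_norm_lt_one c (by rwa [Real.norm_of_nonneg hx0])]
    ring
  rw [totalCost, ← ENNReal.summable.sum_add_tsum_nat_add' (k := N), add_assoc (25 * (N * A)),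
    ENNReal.ofReal_add (by positivity) (by positivity)]
  refine add_le_add ?_ ?_
  · calc ∑ m ∈ Finset.range N, (∏ i ∈ Finset.range m, q (1 + i)) * E (1 + m)
        ≤ ∑ m ∈ Finset.range N, 1 * ENNReal.ofReal (25 * A) := by
          refine Finset.sum_le_sum fun m hm => ?_
          gcongr
          · exact Finset.prod_le_one' fun i _ => hq _
          · exact hE1 m (Finset.mem_range.1 hm)
      _ = ENNReal.ofReal (25 * (N * A)) := by
          rw [one_mul, Finset.sum_const, Finset.card_range, nsmul_eq_mul, ← ENNReal.ofReal_natCast,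
            ← ENNReal.ofReal_mul (by positivity)]
          ring_nf
  · rw [← hsum, ENNReal.ofReal_tsum_of_nonneg (fun l => by positivity) (hs1.add hs2)]
    refine ENNReal.tsum_le_tsum fun l => ?_
    refine (mul_le_mul' (hprod l) (hE2 l)).trans (le_of_eq ?_)
    rw [← ENNReal.ofReal_mul (by positivity)]
    ring_nf

end Recursion

/-! ### Real estimates for the final constant -/

section Estimates

lemma natCast_mul_le_rpow {c N : ℕ} (hc : 1 ≤ c) {A : ℝ} (hA : 0 < A) (hN : (N : ℝ) ^ c ≤ A) :
    N * A ≤ A ^ (1 + 1 / (c : ℝ)) := by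
  have h : (N : ℝ) ≤ A ^ (1 / (c : ℝ)) := by
    rw [one_div, Real.le_rpow_inv_iff_of_pos (by positivity) hA.le (by positivity)]
    simpa using hN
  rw [Real.rpow_add hA, Real.rpow_one, mul_comm]
  gcongr

/-- Compare `a` with `z ^ c`: the product is at most the second summand if `a` is smaller, and at
most the first otherwise. -/
lemma mul_le_rpow_add_pow {c : ℕ} (hc : 1 ≤ c) {a z : ℝ} (ha : 0 < a) (hz : 0 ≤ z) :
    a * z ≤ a ^ (1 + 1 / (c : ℝ)) + z ^ (c + 1) := by
  rcases le_total a (z ^ c) with h | h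
  · calc a * z ≤ z ^ c * z := by gcongr
      _ = z ^ (c + 1) := by ring
      _ ≤ _ := le_add_of_nonneg_left (by positivity)
  · have h1 : z ≤ a ^ (1 / (c : ℝ)) := by
      rw [one_div, Real.le_rpow_inv_iff_of_pos hz ha.le (by positivity)]
      simpa using h
    calc a * z ≤ a * a ^ (1 / (c : ℝ)) := by gcongr
      _ = a ^ (1 + 1 / (c : ℝ)) := by rw [Real.rpow_add ha, Real.rpow_one]
      _ ≤ _ := le_add_of_nonneg_right (by positivity)

/-- The three terms are absorbed separately; the coefficient of the first main term is 25·16 + 25·8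
= 600, and that of the second is smaller. The last summand on the right enters only through being
nonnegative. -/
lemma cost_bound {c N : ℕ} (hc : 1 ≤ c) {A a p : ℝ} (ha : 1 ≤ a) (hA0 : 0 < A)
    (hA : A ≤ 2 * (c + 3) * a) (hp : 0 < p) (hN : (N : ℝ) ^ c ≤ A) :
    25 * (N * A) + 25 * 2 ^ c * (A / (p * (1 - 1 / (2 * (c + 1))))) +
      25 * 2 ^ c * (c ! / (p * (1 - 1 / (2 * (c + 1)))) ^ (c + 1)) ≤
    600 * ((c + 1)! * 2 ^ c * a ^ (1 + 1 / (c : ℝ)) + 2 ^ c * (c + 1)! / p ^ (c + 1) +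
      (c + 1)! * (2 * c) ^ (c + 1)) := by
  have hc1 : (1 : ℝ) ≤ c := by exact_mod_cast hc
  set δ : ℝ := 1 / (2 * (c + 1)) with hδ
  have hδ1 : (c + 1) * δ = 1 / 2 := by rw [hδ]; field_simp
  have hδ0 : 0 < δ := by positivity
  have hδ2 : δ ≤ 1 / 2 := by nlinarith
  set z : ℝ := p⁻¹ with hz
  have hz0 : 0 < z := inv_pos.2 hp
  set f : ℝ := ((c + 1)! : ℝ) with hf
  set e : ℝ := (2 : ℝ) ^ c with he
  set G : ℝ := a ^ (1 + 1 / (c : ℝ)) with hG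
  have hG0 : 0 ≤ G := by positivity
  have hf1 : (c : ℝ) + 1 ≤ f := by
    rw [hf]; exact_mod_cast Nat.self_le_factorial (c + 1)
  have he1 : (c : ℝ) + 1 ≤ e := by
    rw [he]; exact_mod_cast Nat.lt_two_pow_self (n := c)
  have h1 : N * A ≤ 16 * f * e * G := by
    calc N * A ≤ A ^ (1 + 1 / (c : ℝ)) := natCast_mul_le_rpow hc hA0 hN
      _ ≤ (2 * (c + 3) * a) ^ (1 + 1 / (c : ℝ)) := by gcongr
      _ = (2 * (c + 3)) ^ (1 + 1 / (c : ℝ)) * G :=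
          Real.mul_rpow (by positivity) (by positivity)
      _ ≤ (2 * (c + 3)) ^ (2 : ℝ) * G := by
          gcongr
          · linarith
          · have : 1 / (c : ℝ) ≤ 1 := by rw [div_le_one (by positivity)]; exact hc1
            linarith
      -- Since c ≥ 1, 2(c+3) ≤ 4(c+1), and (c+1)² ≤ (c+1)!·2^c.
      _ ≤ 16 * f * e * G := by
          gcongr
          rw [Real.rpow_two]
          nlinarith [mul_le_mul hf1 he1 (by positivity) (by positivity)]
  have h2 : A / (p * (1 - δ)) ≤ 8 * f * (G + z ^ (c + 1)) := by
    calc A / (p * (1 - δ)) ≤ (2 * (c + 3) * a) / (p * (1 / 2)) := by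
          gcongr
          linarith
      _ = 4 * (c + 3) * (a * z) := by rw [hz]; field_simp; ring
      _ ≤ 8 * f * (G + z ^ (c + 1)) := by
          refine mul_le_mul (by linarith) ?_ (by positivity) (by positivity)
          exact mul_le_rpow_add_pow hc (by linarith) hz0.le
  have h3 : c ! / (p * (1 - δ)) ^ (c + 1) ≤ 2 * f * z ^ (c + 1) := by
    -- Bernoulli's inequality; δ is chosen so that (c+1)δ = 1/2.
    have hb : (1 : ℝ) / 2 ≤ (1 - δ) ^ (c + 1) := by
      have := one_add_mul_le_pow (a := -δ) (by linarith) (c + 1)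
      push_cast at this
      have h4 : 1 + ((c : ℝ) + 1) * -δ = 1 / 2 := by linarith
      rw [h4] at this
      simpa [sub_eq_add_neg] using this
    have hcf : ((c ! : ℕ) : ℝ) ≤ f := by
      rw [hf]; exact_mod_cast Nat.factorial_le (Nat.le_succ c)
    rw [mul_pow]
    calc (c ! : ℝ) / (p ^ (c + 1) * (1 - δ) ^ (c + 1)) ≤ f / (p ^ (c + 1) * (1 / 2)) := by gcongr
      _ = 2 * f * z ^ (c + 1) := by rw [hz, inv_pow]; field_simp
  have h4 : e * f / p ^ (c + 1) = f * e * z ^ (c + 1) := by rw [hz, inv_pow]; field_simp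
  have h5 : 0 ≤ f * (2 * (c : ℝ)) ^ (c + 1) := by positivity
  have h6 : 0 ≤ f * e * G := by positivity
  have h7 : 0 ≤ f * e * z ^ (c + 1) := by positivity
  have h2' : e * (A / (p * (1 - δ))) ≤ e * (8 * f * (G + z ^ (c + 1))) := by gcongr
  have h3' : e * (c ! / (p * (1 - δ)) ^ (c + 1)) ≤ e * (2 * f * z ^ (c + 1)) := by gcongr
  rw [h4]
  linarith

end Estimates

/-! ### The bound for blocks of length 2n^c -/

section Main

variable {k : ℕ} {S : Type*} [Finite S] [MeasurableSpace S] [DiscreteMeasurableSpace S]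
  (M : POMC S (Set (Marker k))) {v : ℕ}

lemma Pm_toReal_pos (hv : v ≤ 1) : 0 < (M.Pm v).toReal :=
  ENNReal.toReal_pos (M.Pm_pos hv).ne' (ne_top_of_le_ne_top ENNReal.one_ne_top (M.Pm_le_one v))

lemma Pm_toReal_le_one : (M.Pm v).toReal ≤ 1 := by
  have := ENNReal.toReal_mono ENNReal.one_ne_top (M.Pm_le_one v)
  simpa using this

lemma window_le (hv : v ≤ 1) : (M.window v : ℝ) ≤ 2 * ((M.Rm v : ℝ) / (M.Pm v).toReal) := by
  have hP := M.Pm_toReal_pos hv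
  have h1 : (1 : ℝ) ≤ (M.Pm v).toReal⁻¹ := (one_le_inv₀ hP).2 M.Pm_toReal_le_one
  have h2 := Nat.ceil_lt_add_one (inv_nonneg.2 hP.le)
  rw [window, Nat.cast_mul, div_eq_mul_inv, mul_left_comm]
  gcongr
  linarith

theorem expectedSteps_pow_le (hv : v ≤ 1) (hp : 0 < M.Pgood) {c : ℕ} (hc : 1 ≤ c) :
    M.expectedSteps (fun n => n ^ c) ≤ ENNReal.ofReal (600 *
      ((c + 1)! * 2 ^ c * ((M.Rm v : ℝ) / (M.Pm v).toReal) ^ (1 + 1 / (c : ℝ))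
        + 2 ^ c * (c + 1)! / M.Pgood.toReal ^ (c + 1)
        + (c + 1)! * (2 * c) ^ (c + 1))) := by
  set W := M.window v with hW
  set p := M.Pgood.toReal with hpdef
  have hpt : M.Pgood ≤ 1 := MeasureTheory.prob_le_one
  have hp0 : 0 < p := ENNReal.toReal_pos hp.ne' (ne_top_of_le_ne_top ENNReal.one_ne_top hpt)
  have hp1 : p ≤ 1 := by
    have := ENNReal.toReal_mono ENNReal.one_ne_top hpt
    simpa using this
  have hW0 : 1 ≤ W := M.window_pos hv
  set δ : ℝ := 1 / (2 * (c + 1)) with hδ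
  have hδ0 : 0 < δ := by positivity
  have hδ1 : δ ≤ 1 / 2 := by
    rw [hδ]
    gcongr
    have : (0 : ℝ) ≤ c := by positivity
    linarith
  have hy0 : 0 < p * (1 - δ) := mul_pos hp0 (by linarith)
  have hy1 : p * (1 - δ) ≤ 1 := by nlinarith
  -- This is why `j = c + 3` is used below: c + 1 ≤ 2^c gives 3/(8·2^c) ≤ 1/(2(c+1)).
  have hε : 3 * (2⁻¹ : ℝ) ^ (c + 3) ≤ δ := by
    have h2c : (c : ℝ) + 1 ≤ 2 ^ c := by exact_mod_cast Nat.lt_two_pow_self (n := c)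
    rw [hδ, inv_pow, ← div_eq_mul_inv, div_le_div_iff₀ (by positivity) (by positivity), pow_add]
    linarith
  have hexists : ∃ n, (c + 3) * W ≤ (n + 1) ^ c :=
    ⟨(c + 3) * W, (Nat.le_succ _).trans (Nat.le_self_pow (by omega) _)⟩
  classical
  -- The least `N` for which the next phase is long enough: every phase n > N satisfies n^c ≥
  -- (c+3)W, while minimality keeps N^c ≤ (c+3)W.
  set N := Nat.find hexists with hN
  have hNle : N ^ c ≤ (c + 3) * W := by
    rcases Nat.eq_zero_or_pos N with h0 | h0
    · rw [h0, zero_pow (by omega)]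
      exact Nat.zero_le _
    · have := Nat.find_min hexists (m := N - 1) (by omega)
      rw [Nat.sub_add_cancel h0] at this
      omega
  set A : ℝ := (((c + 3) * W : ℕ) : ℝ) with hA
  have hWA : (W : ℝ) ≤ A := by
    rw [hA]
    exact_mod_cast Nat.le_mul_of_pos_left W (by omega)
  have hA0 : 0 < A := by
    have : (1 : ℝ) ≤ W := by exact_mod_cast hW0
    linarith
  have hNA : (N : ℝ) ^ c ≤ A := by
    rw [hA]
    exact_mod_cast hNle
  have hAa : A ≤ 2 * (c + 3) * ((M.Rm v : ℝ) / (M.Pm v).toReal) := by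
    have := M.window_le hv
    rw [hA]
    push_cast
    calc ((c : ℝ) + 3) * W ≤ (c + 3) * (2 * ((M.Rm v : ℝ) / (M.Pm v).toReal)) := by gcongr
      _ = _ := by ring
  have ha1 : 1 ≤ (M.Rm v : ℝ) / (M.Pm v).toReal := by
    rw [one_le_div (M.Pm_toReal_pos hv)]
    have : (1 : ℝ) ≤ M.Rm v := by exact_mod_cast M.Rm_pos hv
    linarith [M.Pm_toReal_le_one (v := v)]
  have h := totalCost_le (E := fun n => M.phaseCost (n ^ c)) (q := fun n => M.restartProb (n ^ c))
    (c := c) (N := N) (A := A) (x := 1 - p * (1 - δ)) (by linarith) (by linarith) hA0.le hNA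
    ?_ (fun n => M.restartProb_le_one _) ?_
  · refine ((M.expectedSteps_le (fun n => n ^ c) (totalCost (fun n => M.phaseCost (n ^ c))
      fun n => M.restartProb (n ^ c)) fun n _ => (totalCost_eq _ _ n).le).trans h).trans
      (ENNReal.ofReal_le_ofReal ?_)
    rw [sub_sub_cancel]
    exact cost_bound hc ha1 hA0 hAa hp0 hNA
  · intro n hn
    refine (M.phaseCost_le hv (Nat.one_le_pow c n hn)).trans ?_
    rw [← ENNReal.ofReal_natCast]
    refine ENNReal.ofReal_le_ofReal ?_
    push_cast
    linarith
  · intro n hn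
    have hF : (c + 3) * W ≤ n ^ c :=
      (Nat.find_spec hexists).trans (Nat.pow_le_pow_left hn c)
    have h1 := M.restartProb_toReal_le hv (j := c + 3) (by omega) hF
    rw [← ENNReal.ofReal_toReal (ne_top_of_le_ne_top ENNReal.one_ne_top
      (M.restartProb_le_one (n ^ c)))]
    refine ENNReal.ofReal_le_ofReal (h1.trans ?_)
    gcongr

end Main

end POMC

theorem mainTheorem3 :
    ∃ K : ℝ, ∀ (c : ℕ), 1 ≤ c → ∀ (k : ℕ) (S : Type*) [Fintype S] [MeasurableSpace S]
      [DiscreteMeasurableSpace S] (M : POMC S (Set (Marker k))) (v : ℕ), v ≤ 1 → 0 < M.Pgood →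
      M.expectedSteps (fun n => n ^ c) ≤ ENNReal.ofReal (K *
        ((c + 1)! * 2 ^ c * ((M.Rm v : ℝ) / (M.Pm v).toReal) ^ (1 + 1 / (c : ℝ))
          + 2 ^ c * (c + 1)! / M.Pgood.toReal ^ (c + 1)
          + (c + 1)! * (2 * c) ^ (c + 1))) := by
  exact ⟨600, fun c hc k S _ _ _ M v hv hp => M.expectedSteps_pow_le hv hp hc⟩
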